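/- Let $\Sigma$ be a finite alphabet with an irreflexive symmetric independence relation $I$; letters not related by $I$ are called dependent, and words $u,v$ are independent, $u\,I\,v$, if all letters of $u$ are independent of all letters of $v$. Regular expressions are generated by $E,F::=a\mid 0\mid 1\mid E+F\mid EF\mid E^*$ ($a\in\Sigma$), with the usual language $[\![E]\!]$. The trace-closing semantics $[\![E]\!]^I$ is defined by the same clauses, except that concatenation is replaced by the reordering concatenation $L\cdot^I L'=\bigcup_{u\in L,v\in L'}u\cdot^I v$, where $\varepsilon\cdot^I v=\{v\}$, $u\cdot^I\varepsilon=\{u\}$, $au\cdot^I bv=\{a\}(u\cdot^I bv)\cup\{b\mid au\,I\,b\}(au\cdot^I v)$, and $[\![E^*]\!]^I=\mu X.\,\{\varepsilon\}\cup[\![E]\!]^I\cdot^I X$. For a letter $a$, $R_aE$ is $E$ with every letter dependent on $a$ replaced by $0$; $R_\varepsilon E=E$ and $R_{ua}E=R_a(R_uE)$; for $X\subseteq\Sigma$, $R_XE$ is $R_uE$ for any enumeration $u$ of $X$. The Antimirov reordering parts-of-derivatives $E\to^I(a,E')$ are defined inductively by: $a\to^I(a,1)$; if $E\to^I(a,E')$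 then $E+F\to^I(a,E')$, $F+E\to^I(a,E')$, $EF\to^I(a,E'F)$, $FE\to^I(a,(R_aF)E')$ and $E^*\to^I(a,(R_aE)^*(E'E^*))$. For words, $E\to^{I*}(\varepsilon,E)$, and $E\to^{I*}(u,E')$, $E'\to^I(a,E'')$ imply $E\to^{I*}(ua,E'')$. The Antimirov reordering automaton of $E$ is the nondeterministic automaton with states $Q^E=\{E'\mid\exists u.\,E\to^{I*}(u,E')\}$, initial state $E$, transitions $\to^I$, and as final states the (syntactically) nullable members of $Q^E$. Let $\doteq$ be the congruence on regular expressions generated by: associativity of $\cdot$; $1E\doteq E\doteq E1$; $0E\doteq0\doteq E0$; the valid equations between expressions built from $0$ and $1$ only ($0+0\doteq0$, $0+1\doteq1+0\doteq1+1\doteq1$, $0^*\doteq1^*\doteq1$); and $F^*F^*\doteq F^*$. For $n\ge1$, subalphabets $X_0,\dots,X_{n-1}$ and expressions $E_1,\dots,E_n$ put $$\mathrm{dev}(E;X_0,\dots,X_{n-1};E_1,\dots,E_n)=(R_{X_0}E)^*(R_{X_1}E_1)(R_{X_1}E)^*\cdots(R_{X_{n-1}}E_{n-1})(R_{X_{n-1}}E)^*E_nE^*$$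 (nested to the right). Define $E^{\to*}=\{E\}\cup E^{\to+}$, where $a^{\to+}=\{1\}$, $0^{\to+}=1^{\to+}=\emptyset$, $(E+F)^{\to+}=E^{\to+}\cup F^{\to+}$, $(EF)^{\to+}=\{E'F\mid E'\in E^{\to+}\}\cup\{(R_XE')F'\mid\emptyset\ne X\subseteq\Sigma,\ E'\in E^{\to*},\ F'\in F^{\to+}\}$, and $(E^*)^{\to+}=\{\mathrm{dev}(E;X_0,\dots,X_{n-1};E_1,\dots,E_n)\mid n\ge1,\ X_i\neq\emptyset,\ X_{i-1}\supseteq X_i,\ E_i\in E^{\to+}\}$. A word $a_1\cdots a_m$ is connected if the graph on $\{1,\dots,m\}$ with an edge between $i<j$ whenever $a_i,a_j$ are dependent is connected (the empty word counts as connected); a language is connected if all its words are. Star-connected expressions are defined inductively: $0$, $1$, $a$ are star-connected; if $E,F$ are, so are $E+F$ and $EF$; if $E$ is star-connected and $[\![E]\!]$ is connected, then $E^*$ is star-connected. Then: 1. The theory $\doteq$ is sound: $E\doteq F$ implies $[\![E]\!]=[\![F]\!]$. 2. For all $E,E'$ and $u\in\Sigma^*$, if $E\to^{I*}(u,E')$,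 then there is $E''\in E^{\to*}$ with $E'\doteq E''$. 3. For all $E,E'$ and $u\in\Sigma^*$, if $[\![E]\!]$ is connected and $E^*\to^{I*}(u,E')$, then either $u=\varepsilon$ and $E'=E^*$ (the case $n=0$), or there are $1\le n\le|\Sigma|$, nonempty subalphabets $X_0\supsetneq X_1\supsetneq\dots\supsetneq X_{n-1}$ and expressions $E_1,\dots,E_n$, each of them either $0$ or a part-of-derivative of $E$ along some nonempty word, such that $E'\doteq\mathrm{dev}(E;X_0,\dots,X_{n-1};E_1,\dots,E_n)$. 4. If $E$ is star-connected, then the Antimirov reordering automaton of $E$ accepts $[\![E]\!]^I$, the quotient $Q^E/{\doteq}$ of its state set is finite, and the quotient automaton (a class is initial or final if some member is, and there is an $a$-transition between two classes if there is one between some of their members) also accepts $[\![E]\!]^I$. -/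

import Mathlib

noncomputable section

namespace TraceRegex

open RegularExpression

variable {α : Type*}

/-! ### Words and languages over an independence alphabet `(α, I)` -/

/-- Two words are independent if all their letters are pairwise independent. -/
def WordIndep (I : α → α → Prop) (u v : List α) : Prop :=
  ∀ a ∈ u, ∀ b ∈ v, I a b

/-- The undirected graph underlying the dependence graph of a word `w`: the vertices are the
positions of `w`, and there is an edge from `i` to `j` when `i < j` and the letters at `i`
and `j` are dependent. -/
def dependenceGraph (I : α → α → Prop) (w : List α) : SimpleGraph (Fin w.length) :=
  SimpleGraph.fromRel fun i j => i < j ∧ ¬ I (w.get i) (w.get j)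

/-- A word is connected if its dependence graph is connected (the empty word is connected). -/
def WordConnected (I : α → α → Prop) (w : List α) : Prop :=
  (dependenceGraph I w).Preconnected

/-- A language is connected if all its words are. -/
def LangConnected (I : α → α → Prop) (L : Language α) : Prop :=
  ∀ w ∈ L, WordConnected I w

/-- The `I`-reordering concatenation of words. -/
def wordConcat (I : α → α → Prop) : List α → List α → Set (List α)
  | [], v => {v}
  | a :: u, [] => {a :: u}
  | a :: u, b :: v =>
      {w | ∃ z ∈ wordConcat I u (b :: v), w = a :: z} ∪
      {w | WordIndep I (a :: u) [b] ∧ ∃ z ∈ wordConcat I (a :: u) v, w = b :: z}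
termination_by u v => u.length + v.length

/-- The `I`-reordering concatenation of languages. -/
def langConcat (I : α → α → Prop) (L L' : Language α) : Language α :=
  {w | ∃ u ∈ L, ∃ v ∈ L', w ∈ wordConcat I u v}

/-- The trace-closing semantics of regular expressions. The star is interpreted as the least
fixpoint of `X ↦ 1 ∪ ⟦E⟧ᴵ ·ᴵ X`, that is, as the intersection of all its prefixpoints. -/
def traceSem (I : α → α → Prop) : RegularExpression α → Language α
  | .zero => 0
  | .epsilon => 1
  | .char a => {[a]}
  | .plus E F => traceSem I E + traceSem I F
  | .comp E F => langConcat I (traceSem I E) (traceSem I F)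
  | .star E => sInf {X : Language α | 1 + langConcat I (traceSem I E) X ≤ X}

/-- Star-connected expressions. -/
inductive StarConnected (I : α → α → Prop) : RegularExpression α → Prop
  | zero : StarConnected I 0
  | one : StarConnected I 1
  | char (a : α) : StarConnected I (char a)
  | add {E F : RegularExpression α} :
      StarConnected I E → StarConnected I F → StarConnected I (E + F)
  | mul {E F : RegularExpression α} :
      StarConnected I E → StarConnected I F → StarConnected I (E * F)
  | star {E : RegularExpression α} :
      StarConnected I E → LangConnected I E.matches' → StarConnected I (star E)

/-! ### Reorderable parts and reordering parts-of-derivatives -/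

open Classical in
/-- The `I`-reorderable part of a regular expression with respect to a letter. -/
def restr (I : α → α → Prop) (a : α) : RegularExpression α → RegularExpression α
  | .zero => 0
  | .epsilon => 1
  | .char b => if I a b then char b else 0
  | .plus E F => restr I a E + restr I a F
  | .comp E F => restr I a E * restr I a F
  | .star E => star (restr I a E)

/-- The `I`-reorderable part with respect to a word: `R_ε E = E`, `R_{ua} E = R_a (R_u E)`. -/
def restrWord (I : α → α → Prop) (u : List α) (E : RegularExpression α) : RegularExpression α :=
  u.foldl (fun E' a => restr I a E') E

/-- The `I`-reorderable part with respect to a subalphabet `X`: `R_u` for an enumeration `u`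
of `X`. The choice of `u` does not matter, see `restrWord_congr`. -/
def restrSet (I : α → α → Prop) (X : Finset α) (E : RegularExpression α) : RegularExpression α :=
  restrWord I X.toList E

open Classical in
theorem restrWord_char (I : α → α → Prop) (u : List α) (b : α) :
    restrWord I u (char b) = if ∀ a ∈ u, I a b then char b else 0 := by
  have h0 : ∀ u : List α, restrWord I u 0 = 0 := by
    intro u
    induction u with
    | nil => rfl
    | cons a u ih => exact ih
  induction u with
  | nil => simp [restrWord]
  | cons a u ih =>
    change restrWord I u (restr I a (char b)) = _
    by_cases h : I a b
    · simp [restr, h, ih]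
    · simp [restr, h, h0]

/-- `R_u E` depends only on the set of letters that occur in `u`. -/
theorem restrWord_congr (I : α → α → Prop) (u v : List α) (h : ∀ a, a ∈ u ↔ a ∈ v)
    (E : RegularExpression α) : restrWord I u E = restrWord I v E := by
  have h0 : ∀ u : List α, restrWord I u zero = zero := by
    intro u
    induction u with
    | nil => rfl
    | cons a u ih => exact ih
  have h1 : ∀ u : List α, restrWord I u epsilon = epsilon := by
    intro u
    induction u with
    | nil => rfl
    | cons a u ih => exact ih
  have hp : ∀ (u : List α) (E F : RegularExpression α),
      restrWord I u (plus E F) = plus (restrWord I u E) (restrWord I u F) := by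
    intro u
    induction u with
    | nil => intro _ _; rfl
    | cons a u ih => intro E F; exact ih (restr I a E) (restr I a F)
  have hc : ∀ (u : List α) (E F : RegularExpression α),
      restrWord I u (comp E F) = comp (restrWord I u E) (restrWord I u F) := by
    intro u
    induction u with
    | nil => intro _ _; rfl
    | cons a u ih => intro E F; exact ih (restr I a E) (restr I a F)
  have hs : ∀ (u : List α) (E : RegularExpression α),
      restrWord I u (.star E) = .star (restrWord I u E) := by
    intro u
    induction u with
    | nil => intro _; rfl
    | cons a u ih => intro E; exact ih (restr I a E)
  induction E with
  | zero => rw [h0, h0]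
  | epsilon => rw [h1, h1]
  | char b =>
    have hb : (∀ a ∈ u, I a b) ↔ ∀ a ∈ v, I a b :=
      forall_congr' fun a => imp_congr_left (h a)
    rw [restrWord_char, restrWord_char]
    by_cases hu : ∀ a ∈ u, I a b
    · rw [if_pos hu, if_pos (hb.1 hu)]
    · rw [if_neg hu, if_neg (fun hv => hu (hb.2 hv))]
  | plus E F ihE ihF => rw [hp, hp, ihE, ihF]
  | comp E F ihE ihF => rw [hc, hc, ihE, ihF]
  | star E ihE => rw [hs, hs, ihE]

/-- Antimirov `I`-reordering parts-of-derivatives along a letter: `PartDeriv I E a E'` is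
`E →ᴵ (a, E')`. -/
inductive PartDeriv (I : α → α → Prop) :
    RegularExpression α → α → RegularExpression α → Prop
  | char (a : α) : PartDeriv I (char a) a 1
  | add_left {E E' F : RegularExpression α} {a : α} :
      PartDeriv I E a E' → PartDeriv I (E + F) a E'
  | add_right {E F F' : RegularExpression α} {a : α} :
      PartDeriv I F a F' → PartDeriv I (E + F) a F'
  | mul_left {E E' F : RegularExpression α} {a : α} :
      PartDeriv I E a E' → PartDeriv I (E * F) a (E' * F)
  | mul_right {E F F' : RegularExpression α} {a : α} :
      PartDeriv I F a F' → PartDeriv I (E * F) a (restr I a E * F')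
  | star {E E' : RegularExpression α} {a : α} :
      PartDeriv I E a E' → PartDeriv I (star E) a (star (restr I a E) * (E' * star E))

/-- Antimirov `I`-reordering parts-of-derivatives along a word: `PartDerivs I E u E'` is
`E →ᴵ* (u, E')`. -/
inductive PartDerivs (I : α → α → Prop) :
    RegularExpression α → List α → RegularExpression α → Prop
  | nil (E : RegularExpression α) : PartDerivs I E [] E
  | snoc {E E' E'' : RegularExpression α} {u : List α} {a : α} :
      PartDerivs I E u E' → PartDeriv I E' a E'' → PartDerivs I E (u ++ [a]) E''

/-! ### The weak equational theory -/

/-- The equational theory on regular expressions generated by associativity and unit laws of `·`,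
the law that `0` is zero for `·`, the valid equations between expressions built from `0` and `1`
only, and `F* · F* ≐ F*`. -/
inductive WeakEq : RegularExpression α → RegularExpression α → Prop
  | refl (E : RegularExpression α) : WeakEq E E
  | symm {E F : RegularExpression α} : WeakEq E F → WeakEq F E
  | trans {E F G : RegularExpression α} : WeakEq E F → WeakEq F G → WeakEq E G
  | add_congr {E E' F F' : RegularExpression α} :
      WeakEq E E' → WeakEq F F' → WeakEq (E + F) (E' + F')
  | mul_congr {E E' F F' : RegularExpression α} :
      WeakEq E E' → WeakEq F F' → WeakEq (E * F) (E' * F')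
  | star_congr {E E' : RegularExpression α} : WeakEq E E' → WeakEq (star E) (star E')
  | mul_assoc (E F G : RegularExpression α) : WeakEq (E * F * G) (E * (F * G))
  | one_mul (E : RegularExpression α) : WeakEq (1 * E) E
  | mul_one (E : RegularExpression α) : WeakEq (E * 1) E
  | zero_mul (E : RegularExpression α) : WeakEq (0 * E) 0
  | mul_zero (E : RegularExpression α) : WeakEq (E * 0) 0
  | zero_add_zero : WeakEq (0 + 0) 0
  | zero_add_one : WeakEq (0 + 1) 1
  | one_add_zero : WeakEq (1 + 0) 1
  | one_add_one : WeakEq (1 + 1) 1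
  | star_zero : WeakEq (star 0) 1
  | star_one : WeakEq (star 1) 1
  | star_mul_star (F : RegularExpression α) : WeakEq (star F * star F) (star F)

/-! ### Star developments and the set `E^{→*}` -/

/-- `starTail I E [(X₁, E₁), …, (Xₙ₋₁, Eₙ₋₁)] Eₙ` is
`(R_{X₁} E₁) (R_{X₁} E)* … (R_{Xₙ₋₁} Eₙ₋₁) (R_{Xₙ₋₁} E)* Eₙ E*`. -/
def starTail (I : α → α → Prop) (E : RegularExpression α) :
    List (Finset α × RegularExpression α) → RegularExpression α → RegularExpression α
  | [], En => En * star E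
  | (X, F) :: l, En => restrSet I X F * (star (restrSet I X E) * starTail I E l En)

/-- `starDev I E X₀ [(X₁, E₁), …, (Xₙ₋₁, Eₙ₋₁)] Eₙ` is
`(R_{X₀} E)* (R_{X₁} E₁) (R_{X₁} E)* … (R_{Xₙ₋₁} Eₙ₋₁) (R_{Xₙ₋₁} E)* Eₙ E*`;
the number `n` is one more than the length of the list. -/
def starDev (I : α → α → Prop) (E : RegularExpression α) (X₀ : Finset α)
    (l : List (Finset α × RegularExpression α)) (En : RegularExpression α) :
    RegularExpression α :=
  star (restrSet I X₀ E) * starTail I E l En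

/-- The set `E^{→+}`. -/
def succPlus (I : α → α → Prop) : RegularExpression α → Set (RegularExpression α)
  | .zero => ∅
  | .epsilon => ∅
  | .char _ => {1}
  | .plus E F => succPlus I E ∪ succPlus I F
  | .comp E F =>
      {G | ∃ E' ∈ succPlus I E, G = E' * F} ∪
      {G | ∃ X : Finset α, X.Nonempty ∧
        ∃ E' ∈ {E} ∪ succPlus I E, ∃ F' ∈ succPlus I F, G = restrSet I X E' * F'}
  | .star E =>
      {G | ∃ (X₀ : Finset α) (l : List (Finset α × RegularExpression α))
          (En : RegularExpression α),
        X₀.Nonempty ∧ (∀ p ∈ l, p.1.Nonempty ∧ p.2 ∈ succPlus I E) ∧ En ∈ succPlus I E ∧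
        List.IsChain (fun X Y => Y ⊆ X) (X₀ :: l.map Prod.fst) ∧
        G = starDev I E X₀ l En}

/-- The set `E^{→*} = {E} ∪ E^{→+}`. -/
def succStar (I : α → α → Prop) (E : RegularExpression α) : Set (RegularExpression α) :=
  {E} ∪ succPlus I E

/-! ### The Antimirov reordering automaton and its quotients -/

/-- The state set of the Antimirov reordering automaton of `E`. -/
def AntState (I : α → α → Prop) (E : RegularExpression α) : Type _ :=
  {E' : RegularExpression α // ∃ u : List α, PartDerivs I E u E'}

/-- The Antimirov reordering automaton of `E`. -/
def antimirovNFA (I : α → α → Prop) (E : RegularExpression α) : NFA α (AntState I E) where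
  step p a := {q | PartDeriv I p.1 a q.1}
  start := {p | p.1 = E}
  accept := {p | p.1.matchEpsilon = true}

/-- The quotient of a nondeterministic automaton by an equivalence relation on its states. -/
def quotientNFA {σ : Type*} (M : NFA α σ) (s : Setoid σ) : NFA α (Quotient s) where
  step c a := {d | ∃ p q : σ, Quotient.mk s p = c ∧ Quotient.mk s q = d ∧ q ∈ M.step p a}
  start := {c | ∃ p ∈ M.start, Quotient.mk s p = c}
  accept := {c | ∃ p ∈ M.accept, Quotient.mk s p = c}

/-- The weak equational theory, as an equivalence relation on the states. -/
def weakSetoid (I : α → α → Prop) (E : RegularExpression α) : Setoid (AntState I E) where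
  r p q := WeakEq p.1 q.1
  iseqv := ⟨fun p => WeakEq.refl p.1, fun h => WeakEq.symm h, fun h h' => WeakEq.trans h h'⟩

end TraceRegex

end

open TraceRegex

/-!
The semantic part rests on one recursion for the reordering concatenation: a word `a :: w` lies in
`L ·ᴵ L'` iff either `w ∈ a⁻¹L ·ᴵ L'`, or `w ∈ R_a L ·ᴵ a⁻¹L'`, where `R_a L` consists of the words
of `L` that are independent of `a` (`cons_mem_langConcat`). It gives associativity of `·ᴵ`
(`langConcat_assoc`), the left quotients of an iteration (`leftQuot_langStar`), and hence that
parts-of-derivatives compute the left quotients of the trace-closing semantics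
(`cons_mem_traceSem`), so that the Antimirov automaton is correct for every expression. The weak
theory is also sound for the trace-closing semantics (`WeakEq.traceSem_eq`), so identifying
equivalent states does not change the accepted language.

The syntactic part describes derivatives along words. A derivative of `E * F` is `(R_X E') F'` with
`X` the set of letters taken from `F` (`PartDerivs.mul_inv`). A derivative of `E*` along a nonempty
word is, up to rebracketing, a star development whose components `Eᵢ` are derivatives of `E` along
nonempty words over `Xᵢ₋₁ ⊇ Xᵢ` (`PartDerivs.star_inv`). The weak theory itself is not a
bisimulation, since `0 E` may have derivatives while `0` has none, so the step argument works
modulo associativity only (`AssocEq.bisim`).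

Connectedness of the language of `E` enters when `Xᵢ₋₁ = Xᵢ`. Then `R_{Xᵢ} Eᵢ` contains only words
independent of the nonempty word that led to `Eᵢ`, and both together form a permutation of a
connected word of `E`; so it contains at most the empty word, and the theory proves it equal to `0`
or `1` (`restrSet_weakEq_zero_or_one`). In the first case the whole development is `0`, in the
second the adjacent equal stars merge. What remains is a strictly decreasing chain of subalphabets,
whose length is at most the size of the alphabet; this yields finiteness by induction on
star-connected expressions (`StarConnected.finiteDerivs`).
-/

noncomputable section

namespace TraceRegex

open RegularExpression

variable {α : Type*}

/-! ### Soundness of the weak theory -/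

theorem WeakEq.matches'_eq {E F : RegularExpression α} (h : WeakEq E F) :
    E.matches' = F.matches' := by
  induction h with
  | refl => rfl
  | symm _ ih => exact ih.symm
  | trans _ _ ih ih' => exact ih.trans ih'
  | add_congr _ _ ih ih' => simp only [matches'_add, ih, ih']
  | mul_congr _ _ ih ih' => simp only [matches'_mul, ih, ih']
  | star_congr _ ih => simp only [matches'_star, ih]
  | mul_assoc => simp only [matches'_mul, _root_.mul_assoc]
  | star_mul_star => simp only [matches'_mul, matches'_star, kstar_mul_kstar]
  | _ => simp

/-! ### Reordering concatenation -/

/-- The words of `L` all of whose letters are independent of `a`. -/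
def indepPart (I : α → α → Prop) (a : α) (L : Language α) : Language α :=
  {w | w ∈ L ∧ ∀ b ∈ w, I b a}

/-- The left quotient `a⁻¹ L`. -/
def leftQuot (a : α) (L : Language α) : Language α := {w | a :: w ∈ L}

variable {I : α → α → Prop}

theorem mem_indepPart {a : α} {L : Language α} {w : List α} :
    w ∈ indepPart I a L ↔ w ∈ L ∧ ∀ b ∈ w, I b a := Iff.rfl

theorem mem_leftQuot {a : α} {L : Language α} {w : List α} :
    w ∈ leftQuot a L ↔ a :: w ∈ L := Iff.rfl

theorem mem_langConcat {L L' : Language α} {w : List α} :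
    w ∈ langConcat I L L' ↔ ∃ u ∈ L, ∃ v ∈ L', w ∈ wordConcat I u v := Iff.rfl

theorem nil_mem_wordConcat {u v : List α} : [] ∈ wordConcat I u v ↔ u = [] ∧ v = [] := by
  cases u <;> cases v <;> simp [wordConcat]

theorem cons_mem_wordConcat {a : α} {w u v : List α} :
    a :: w ∈ wordConcat I u v ↔
      (∃ u', u = a :: u' ∧ w ∈ wordConcat I u' v) ∨
      (∃ v', v = a :: v' ∧ (∀ b ∈ u, I b a) ∧ w ∈ wordConcat I u v') := by
  cases u with
  | nil =>
    cases v with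
    | nil => simp [wordConcat]
    | cons b v => simp [wordConcat]; grind
  | cons c u =>
    cases v with
    | nil => cases u <;> simp [wordConcat] <;> grind
    | cons b v =>
      rw [wordConcat]
      simp only [WordIndep, Set.mem_union, Set.mem_ofPred_eq, List.mem_singleton, forall_eq]
      grind

theorem mem_of_mem_wordConcat {w u v : List α} (h : w ∈ wordConcat I u v) (b : α) :
    b ∈ w ↔ b ∈ u ∨ b ∈ v := by
  induction w generalizing u v with
  | nil => obtain ⟨rfl, rfl⟩ := nil_mem_wordConcat.1 h; simp
  | cons a w ih =>
    obtain ⟨u', rfl, h'⟩ | ⟨v', rfl, -, h'⟩ := cons_mem_wordConcat.1 h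
    · simp [ih h', or_assoc]
    · simp [ih h', or_left_comm]

theorem nil_mem_langConcat {L L' : Language α} :
    [] ∈ langConcat I L L' ↔ [] ∈ L ∧ [] ∈ L' := by
  simp [mem_langConcat, nil_mem_wordConcat]

theorem cons_mem_langConcat {a : α} {w : List α} {L L' : Language α} :
    a :: w ∈ langConcat I L L' ↔
      w ∈ langConcat I (leftQuot a L) L' ∨
      w ∈ langConcat I (indepPart I a L) (leftQuot a L') := by
  simp only [mem_langConcat, cons_mem_wordConcat, mem_leftQuot, mem_indepPart]
  grind

theorem leftQuot_langConcat (a : α) (L L' : Language α) :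
    leftQuot a (langConcat I L L') =
      langConcat I (leftQuot a L) L' + langConcat I (indepPart I a L) (leftQuot a L') := by
  ext w; exact cons_mem_langConcat

theorem indepPart_langConcat (a : α) (L L' : Language α) :
    indepPart I a (langConcat I L L') =
      langConcat I (indepPart I a L) (indepPart I a L') := by
  ext w
  simp only [mem_langConcat, mem_indepPart]
  constructor
  · rintro ⟨⟨u, hu, v, hv, h⟩, hw⟩
    have := mem_of_mem_wordConcat h
    exact ⟨u, ⟨hu, fun b hb => hw b ((this b).2 (.inl hb))⟩,
      v, ⟨hv, fun b hb => hw b ((this b).2 (.inr hb))⟩, h⟩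
  · rintro ⟨u, ⟨hu, hu'⟩, v, ⟨hv, hv'⟩, h⟩
    exact ⟨⟨u, hu, v, hv, h⟩, fun b hb => ((mem_of_mem_wordConcat h b).1 hb).elim (hu' b) (hv' b)⟩

theorem langConcat_mono {L₁ L₂ M₁ M₂ : Language α} (h : L₁ ≤ L₂) (h' : M₁ ≤ M₂) :
    langConcat I L₁ M₁ ≤ langConcat I L₂ M₂ := by
  rintro w ⟨u, hu, v, hv, hw⟩
  exact ⟨u, h hu, v, h' hv, hw⟩

theorem add_langConcat (L L' M : Language α) :
    langConcat I (L + L') M = langConcat I L M + langConcat I L' M := by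
  ext w
  simp only [mem_langConcat, Language.mem_add]
  grind

theorem langConcat_add (L M M' : Language α) :
    langConcat I L (M + M') = langConcat I L M + langConcat I L M' := by
  ext w
  simp only [mem_langConcat, Language.mem_add]
  grind

/-- Both bracketings have the same left quotients, so they agree by induction on the word. -/
theorem langConcat_assoc (A B C : Language α) :
    langConcat I (langConcat I A B) C = langConcat I A (langConcat I B C) := by
  ext w
  induction w generalizing A B C with
  | nil => simp only [nil_mem_langConcat, and_assoc]
  | cons a w ih =>
    simp only [cons_mem_langConcat, leftQuot_langConcat, indepPart_langConcat, add_langConcat,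
      langConcat_add, Language.mem_add, ih, or_assoc]

theorem one_langConcat (L : Language α) : langConcat I 1 L = L := by
  ext w
  simp [mem_langConcat, Language.mem_one, wordConcat]

theorem wordConcat_nil (u : List α) : wordConcat I u [] = {u} := by
  cases u <;> simp [wordConcat]

theorem langConcat_one (L : Language α) : langConcat I L 1 = L := by
  ext w
  simp [mem_langConcat, Language.mem_one, wordConcat_nil]

theorem zero_langConcat (L : Language α) : langConcat I 0 L = 0 := by
  ext w
  simp [mem_langConcat, Language.notMem_zero]

theorem langConcat_zero (L : Language α) : langConcat I L 0 = 0 := by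
  ext w
  simp [mem_langConcat, Language.notMem_zero]

/-! ### Iterated reordering concatenation -/

/-- The least `X` with `1 + L ·ᴵ X ≤ X`. -/
def langStar (I : α → α → Prop) (L : Language α) : Language α :=
  sInf {X : Language α | 1 + langConcat I L X ≤ X}

theorem langStar_le {L X : Language α} (h1 : [] ∈ X) (h : langConcat I L X ≤ X) :
    langStar I L ≤ X := by
  refine sInf_le ?_
  rintro w (rfl | hw)
  exacts [h1, h hw]

theorem langStar_prefix (L : Language α) :
    1 + langConcat I L (langStar I L) ≤ langStar I L := by
  refine le_sInf fun X hX => le_trans ?_ hX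
  exact add_le_add_right (langConcat_mono le_rfl (sInf_le hX)) 1

theorem one_le_langStar (L : Language α) : 1 ≤ langStar I L :=
  le_trans (fun _ h => Or.inl h) (langStar_prefix L)

theorem langConcat_langStar_le (L : Language α) :
    langConcat I L (langStar I L) ≤ langStar I L :=
  le_trans (fun _ h => Or.inr h) (langStar_prefix L)

theorem nil_mem_langStar (L : Language α) : [] ∈ langStar I L :=
  one_le_langStar L Language.nil_mem_one

theorem langStar_mul_langStar (L : Language α) :
    langConcat I (langStar I L) (langStar I L) = langStar I L := by
  apply le_antisymm
  · -- the set of words `u` with `{u} ·ᴵ S ≤ S` is closed under the rules that define `S`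
    let X : Language α := {u | langConcat I {u} (langStar I L) ≤ langStar I L}
    have hX : langStar I L ≤ X := by
      refine langStar_le (one_langConcat (langStar I L)).le ?_
      rintro w ⟨u, hu, v, hv, hw⟩
      change langConcat I {w} (langStar I L) ≤ langStar I L
      have h1 : ({w} : Language α) ≤ langConcat I L {v} := by
        rintro _ rfl
        exact ⟨u, hu, v, rfl, hw⟩
      refine (langConcat_mono h1 le_rfl).trans ?_
      rw [langConcat_assoc]
      exact (langConcat_mono le_rfl hv).trans (langConcat_langStar_le L)
    rintro w ⟨u, hu, v, hv, hw⟩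
    exact hX hu ⟨u, rfl, v, hv, hw⟩
  · intro w hw
    exact ⟨[], nil_mem_langStar L, w, hw, by simp [wordConcat]⟩

theorem langStar_eq_one {L : Language α} (h : L ≤ 1) : langStar I L = 1 := by
  apply le_antisymm _ (one_le_langStar L)
  exact langStar_le Language.nil_mem_one ((langConcat_one L).le.trans h)

theorem indepPart_langStar (a : α) (L : Language α) :
    indepPart I a (langStar I L) = langStar I (indepPart I a L) := by
  apply le_antisymm
  · let X : Language α := {w | (∀ b ∈ w, I b a) → w ∈ langStar I (indepPart I a L)}
    have hX : langStar I L ≤ X := by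
      refine langStar_le (fun _ => nil_mem_langStar _) ?_
      rintro w ⟨u, hu, v, hv, hw⟩ h
      have hm := mem_of_mem_wordConcat hw
      exact langConcat_langStar_le _
        ⟨u, ⟨hu, fun b hb => h b ((hm b).2 (.inl hb))⟩, v,
          hv fun b hb => h b ((hm b).2 (.inr hb)), hw⟩
    exact fun w hw => hX hw.1 hw.2
  · refine langStar_le ⟨nil_mem_langStar L, by simp⟩ ?_
    rw [← indepPart_langConcat]
    exact fun w hw => ⟨langConcat_langStar_le L hw.1, hw.2⟩

/-- A word of the iteration that starts with `a` takes this letter from some factor, and all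
earlier factors are independent of `a`. -/
theorem leftQuot_langStar (a : α) (L : Language α) :
    leftQuot a (langStar I L) =
      langConcat I (langStar I (indepPart I a L))
        (langConcat I (leftQuot a L) (langStar I L)) := by
  set R := langConcat I (langStar I (indepPart I a L))
        (langConcat I (leftQuot a L) (langStar I L)) with hR
  apply le_antisymm
  · let X : Language α := {w | w ∈ langStar I L ∧ ∀ w', w = a :: w' → w' ∈ R}
    have hX : langStar I L ≤ X := by
      refine langStar_le ⟨nil_mem_langStar L, by simp⟩ fun w hw => ?_
      have hw' := langConcat_mono (I := I) le_rfl (fun _ h => h.1 : X ≤ langStar I L) hw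
      refine ⟨langConcat_langStar_le _ hw', ?_⟩
      rintro w' rfl
      obtain h | h := cons_mem_langConcat.1 hw
      · exact ⟨[], nil_mem_langStar _, w',
          langConcat_mono le_rfl (fun _ h => h.1 : X ≤ langStar I L) h, by simp [wordConcat]⟩
      · have h1 : leftQuot a X ≤ R := fun w hw => hw.2 w rfl
        have h2 := langConcat_mono (I := I) le_rfl h1 h
        rw [hR, ← langConcat_assoc] at h2
        exact langConcat_mono (langConcat_langStar_le _) le_rfl h2
    exact fun w hw => (hX hw).2 w rfl
  · intro w hw
    have h1 : a :: w ∈ langConcat I (langStar I L) (langConcat I L (langStar I L)) := by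
      refine cons_mem_langConcat.2 (.inr ?_)
      rw [indepPart_langStar, leftQuot_langConcat]
      exact langConcat_mono le_rfl (fun _ h => Or.inl h) hw
    have h2 := langConcat_mono le_rfl (langConcat_langStar_le L) h1
    rwa [langStar_mul_langStar] at h2

/-! ### Derivatives compute the trace-closing semantics -/

theorem traceSem_zero : traceSem I (0 : RegularExpression α) = 0 := rfl

theorem traceSem_one : traceSem I (1 : RegularExpression α) = 1 := rfl

theorem traceSem_char (a : α) : traceSem I (char a) = {[a]} := rfl

theorem traceSem_add (E F : RegularExpression α) :
    traceSem I (E + F) = traceSem I E + traceSem I F := rfl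

theorem traceSem_mul (E F : RegularExpression α) :
    traceSem I (E * F) = langConcat I (traceSem I E) (traceSem I F) := rfl

theorem traceSem_star (E : RegularExpression α) :
    traceSem I (star E) = langStar I (traceSem I E) := rfl

theorem WeakEq.traceSem_eq {E F : RegularExpression α} (h : WeakEq E F) :
    traceSem I E = traceSem I F := by
  induction h with
  | refl => rfl
  | symm _ ih => exact ih.symm
  | trans _ _ ih ih' => exact ih.trans ih'
  | add_congr _ _ ih ih' => simp only [traceSem_add, ih, ih']
  | mul_congr _ _ ih ih' => simp only [traceSem_mul, ih, ih']
  | star_congr _ ih => simp only [traceSem_star, ih]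
  | mul_assoc => simp only [traceSem_mul, langConcat_assoc]
  | one_mul => simp only [traceSem_mul, traceSem_one, one_langConcat]
  | mul_one => simp only [traceSem_mul, traceSem_one, langConcat_one]
  | zero_mul => simp only [traceSem_mul, traceSem_zero, zero_langConcat]
  | mul_zero => simp only [traceSem_mul, traceSem_zero, langConcat_zero]
  | star_zero => exact langStar_eq_one bot_le
  | star_one => exact langStar_eq_one le_rfl
  | star_mul_star => simp only [traceSem_mul, traceSem_star, langStar_mul_langStar]
  | _ => simp [traceSem_add, traceSem_zero, traceSem_one]

theorem nil_mem_traceSem (E : RegularExpression α) :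
    [] ∈ traceSem I E ↔ E.matchEpsilon = true := by
  induction E with
  | zero => simp [traceSem, matchEpsilon, Language.notMem_zero]
  | epsilon => simp [traceSem, matchEpsilon]
  | char a =>
    simp only [traceSem, matchEpsilon, Bool.false_eq_true, iff_false]
    exact fun h => List.cons_ne_nil _ _ (Set.mem_singleton_iff.1 h).symm
  | plus E F ihE ihF => simp [traceSem, matchEpsilon, Language.mem_add, ihE, ihF]
  | comp E F ihE ihF => simp [traceSem, matchEpsilon, nil_mem_langConcat, ihE, ihF]
  | star E ih => exact iff_of_true (nil_mem_langStar (traceSem I E)) rfl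

theorem indepPart_add (a : α) (L M : Language α) :
    indepPart I a (L + M) = indepPart I a L + indepPart I a M := by
  ext w
  simp only [mem_indepPart, Language.mem_add, or_and_right]

theorem traceSem_restr (hsymm : ∀ a b, I a b → I b a) (a : α) (E : RegularExpression α) :
    traceSem I (restr I a E) = indepPart I a (traceSem I E) := by
  induction E with
  | zero => ext w; simp [restr, traceSem, mem_indepPart, Language.notMem_zero]
  | epsilon =>
    ext w
    simp only [restr, traceSem_one, traceSem, mem_indepPart, Language.mem_one]
    constructor
    · rintro rfl; simp
    · exact fun h => h.1
  | char b =>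
    ext w
    have hb : ∀ w : List α, w ∈ ({[b]} : Language α) ↔ w = [b] := fun _ => Iff.rfl
    rw [restr]
    split_ifs with h
    · simp only [traceSem_char, mem_indepPart, hb]
      constructor
      · rintro rfl; simpa using hsymm _ _ h
      · exact fun h => h.1
    · simp only [traceSem_zero, traceSem_char, mem_indepPart, hb, Language.notMem_zero, false_iff]
      rintro ⟨rfl, h'⟩
      exact h (hsymm _ _ (h' b (by simp)))
  | plus E F ihE ihF => simp only [restr, traceSem_add, ihE, ihF, traceSem, indepPart_add]
  | comp E F ihE ihF =>
    simp only [restr, traceSem_mul, ihE, ihF, traceSem, indepPart_langConcat]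
  | star E ih => simp only [restr, traceSem_star, ih, indepPart_langStar]

theorem PartDeriv.zero_inv {a : α} {G : RegularExpression α} : ¬ PartDeriv I 0 a G := by
  generalize h : (0 : RegularExpression α) = E
  rintro (_ | _ | _ | _ | _ | _) <;> cases h

theorem PartDeriv.one_inv {a : α} {G : RegularExpression α} : ¬ PartDeriv I 1 a G := by
  generalize h : (1 : RegularExpression α) = E
  rintro (_ | _ | _ | _ | _ | _) <;> cases h

theorem partDeriv_char {a b : α} {G : RegularExpression α} :
    PartDeriv I (char b) a G ↔ a = b ∧ G = 1 := by
  constructor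
  · generalize h : char b = E
    rintro (_ | _ | _ | _ | _ | _) <;> cases h
    exact ⟨rfl, rfl⟩
  · rintro ⟨rfl, rfl⟩
    exact .char a

theorem partDeriv_add {a : α} {E F G : RegularExpression α} :
    PartDeriv I (E + F) a G ↔ PartDeriv I E a G ∨ PartDeriv I F a G := by
  constructor
  · generalize h : E + F = H
    rintro (_ | h' | h' | _ | _ | _) <;> cases h
    exacts [.inl h', .inr h']
  · rintro (h | h)
    exacts [.add_left h, .add_right h]

theorem partDeriv_mul {a : α} {E F G : RegularExpression α} :
    PartDeriv I (E * F) a G ↔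
      (∃ E', PartDeriv I E a E' ∧ G = E' * F) ∨
      (∃ F', PartDeriv I F a F' ∧ G = restr I a E * F') := by
  constructor
  · generalize h : E * F = H
    rintro (_ | _ | _ | h' | h' | _) <;> cases h
    exacts [.inl ⟨_, h', rfl⟩, .inr ⟨_, h', rfl⟩]
  · rintro (⟨_, h, rfl⟩ | ⟨_, h, rfl⟩)
    exacts [.mul_left h, .mul_right h]

theorem partDeriv_star {a : α} {E G : RegularExpression α} :
    PartDeriv I (star E) a G ↔
      ∃ E', PartDeriv I E a E' ∧ G = star (restr I a E) * (E' * star E) := by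
  constructor
  · generalize h : star E = H
    rintro (_ | _ | _ | _ | _ | h') <;> cases h
    exact ⟨_, h', rfl⟩
  · rintro ⟨_, h, rfl⟩
    exact .star h

theorem cons_mem_traceSem (hsymm : ∀ a b, I a b → I b a) (a : α) (E : RegularExpression α)
    (w : List α) :
    a :: w ∈ traceSem I E ↔ ∃ E', PartDeriv I E a E' ∧ w ∈ traceSem I E' := by
  induction E generalizing w with
  | zero =>
    constructor
    · intro h; cases h
    · rintro ⟨_, h, _⟩; exact (h.zero_inv).elim
  | epsilon =>
    constructor
    · intro h; cases h
    · rintro ⟨_, h, _⟩; exact (h.one_inv).elim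
  | char b =>
    have hb : ∀ w : List α, w ∈ ({[b]} : Language α) ↔ w = [b] := fun _ => Iff.rfl
    simp only [traceSem_char, partDeriv_char, hb, List.cons.injEq]
    constructor
    · rintro ⟨rfl, rfl⟩
      exact ⟨1, ⟨rfl, rfl⟩, Language.nil_mem_one⟩
    · rintro ⟨_, ⟨rfl, rfl⟩, h⟩
      exact ⟨rfl, h⟩
  | plus E F ihE ihF =>
    change _ ∈ traceSem I E + traceSem I F ↔ ∃ E', PartDeriv I (E + F) a E' ∧ _
    simp only [Language.mem_add, ihE, ihF, partDeriv_add, or_and_right, exists_or]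
  | comp E F ihE ihF =>
    change _ ∈ langConcat I (traceSem I E) (traceSem I F) ↔ ∃ E', PartDeriv I (E * F) a E' ∧ _
    simp only [cons_mem_langConcat, partDeriv_mul, or_and_right, exists_or]
    refine or_congr ?_ ?_
    · simp only [mem_langConcat, mem_leftQuot, ihE]
      constructor
      · rintro ⟨u, ⟨E', h, hu⟩, v, hv, hw⟩
        exact ⟨_, ⟨E', h, rfl⟩, u, hu, v, hv, hw⟩
      · rintro ⟨_, ⟨E', h, rfl⟩, u, hu, v, hv, hw⟩
        exact ⟨u, ⟨E', h, hu⟩, v, hv, hw⟩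
    · simp only [← traceSem_restr hsymm, mem_langConcat, mem_leftQuot, ihF]
      constructor
      · rintro ⟨u, hu, v, ⟨F', h, hv⟩, hw⟩
        exact ⟨_, ⟨F', h, rfl⟩, u, hu, v, hv, hw⟩
      · rintro ⟨_, ⟨F', h, rfl⟩, u, hu, v, hv, hw⟩
        exact ⟨u, hu, v, ⟨F', h, hv⟩, hw⟩
  | star E ih =>
    rw [← mem_leftQuot, traceSem_star, leftQuot_langStar, ← traceSem_restr hsymm]
    simp only [partDeriv_star]
    constructor
    · rintro ⟨u, hu, v, ⟨x, hx, y, hy, hv⟩, hw⟩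
      obtain ⟨E', h, hx'⟩ := (ih x).1 hx
      exact ⟨_, ⟨E', h, rfl⟩, u, hu, v, ⟨x, hx', y, hy, hv⟩, hw⟩
    · rintro ⟨_, ⟨E', h, rfl⟩, u, hu, v, ⟨x, hx, y, hy, hv⟩, hw⟩
      exact ⟨u, hu, v, ⟨x, (ih x).2 ⟨E', h, hx⟩, y, hy, hv⟩, hw⟩

theorem PartDerivs.trans {E F G : RegularExpression α} {u v : List α}
    (h : PartDerivs I E u F) (h' : PartDerivs I F v G) : PartDerivs I E (u ++ v) G := by
  induction h' with
  | nil => simpa using h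
  | snoc _ h2 ih => rw [← List.append_assoc]; exact .snoc ih h2

theorem PartDeriv.partDerivs {E F : RegularExpression α} {a : α} (h : PartDeriv I E a F) :
    PartDerivs I E [a] F :=
  .snoc (u := []) (.nil E) h

theorem PartDerivs.eq_of_nil {E F : RegularExpression α} {u : List α} (h : PartDerivs I E u F)
    (hu : u = []) : F = E := by
  cases h with
  | nil => rfl
  | snoc => simp at hu

theorem PartDerivs.exists_cons {E F : RegularExpression α} {a : α} {u w : List α}
    (h : PartDerivs I E w F) (hw : w = a :: u) :
    ∃ E', PartDeriv I E a E' ∧ PartDerivs I E' u F := by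
  induction h generalizing u with
  | nil => cases hw
  | @snoc E' E'' v b h h' ih =>
    cases v with
    | nil =>
      simp only [List.nil_append, List.cons.injEq] at hw
      obtain ⟨rfl, rfl⟩ := hw
      cases h.eq_of_nil rfl
      exact ⟨_, h', .nil _⟩
    | cons c v =>
      simp only [List.cons_append, List.cons.injEq] at hw
      obtain ⟨rfl, rfl⟩ := hw
      obtain ⟨G, h1, h2⟩ := ih rfl
      exact ⟨G, h1, h2.snoc h'⟩

/-! ### The Antimirov automaton and its quotient -/

theorem antimirovNFA_mem_acceptsFrom (hsymm : ∀ a b, I a b → I b a) (E : RegularExpression α)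
    (w : List α) (S : Set (AntState I E)) :
    w ∈ (antimirovNFA I E).acceptsFrom S ↔ ∃ p ∈ S, w ∈ traceSem I p.1 := by
  induction w generalizing S with
  | nil =>
    simp only [NFA.nil_mem_acceptsFrom, nil_mem_traceSem]
    rfl
  | cons a w ih =>
    rw [NFA.cons_mem_acceptsFrom, ih]
    simp only [NFA.mem_stepSet, cons_mem_traceSem hsymm]
    constructor
    · rintro ⟨q, ⟨p, hp, hpq⟩, hw⟩
      exact ⟨p, hp, q.1, hpq, hw⟩
    · rintro ⟨p, hp, F, hpF, hw⟩
      obtain ⟨u, hu⟩ := p.2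
      exact ⟨⟨F, _, hu.snoc hpF⟩, ⟨p, hp, hpF⟩, hw⟩

theorem antimirovNFA_accepts (hsymm : ∀ a b, I a b → I b a) (E : RegularExpression α) :
    (antimirovNFA I E).accepts = traceSem I E := by
  ext w
  rw [NFA.accepts_eq_acceptsFrom_start, antimirovNFA_mem_acceptsFrom hsymm]
  constructor
  · rintro ⟨p, hp, hw⟩
    rwa [show p.1 = E from hp] at hw
  · exact fun hw => ⟨⟨E, [], .nil E⟩, rfl, hw⟩

/-- Merging states with equal languages does not enlarge the accepted language. -/
theorem quotientNFA_mem_acceptsFrom (hsymm : ∀ a b, I a b → I b a) (E : RegularExpression α)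
    (w : List α) (S : Set (Quotient (weakSetoid I E))) :
    w ∈ (quotientNFA (antimirovNFA I E) (weakSetoid I E)).acceptsFrom S ↔
      ∃ p : AntState I E, Quotient.mk (weakSetoid I E) p ∈ S ∧ w ∈ traceSem I p.1 := by
  induction w generalizing S with
  | nil =>
    rw [NFA.nil_mem_acceptsFrom]
    constructor
    · rintro ⟨c, hc, p, hp, rfl⟩
      exact ⟨p, hc, (nil_mem_traceSem _).2 hp⟩
    · rintro ⟨p, hp, hw⟩
      exact ⟨_, hp, p, (nil_mem_traceSem _).1 hw, rfl⟩
  | cons a w ih =>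
    rw [NFA.cons_mem_acceptsFrom, ih]
    simp only [NFA.mem_stepSet, cons_mem_traceSem hsymm]
    constructor
    · rintro ⟨q', ⟨c, hc, p, q, rfl, hq, hpq⟩, hw⟩
      have hqq' : WeakEq q.1 q'.1 := Quotient.exact hq
      exact ⟨p, hc, q.1, hpq, by rwa [hqq'.traceSem_eq]⟩
    · rintro ⟨p, hp, F, hpF, hw⟩
      obtain ⟨u, hu⟩ := p.2
      let q : AntState I E := ⟨F, _, hu.snoc hpF⟩
      exact ⟨q, ⟨_, hp, p, q, rfl, rfl, hpF⟩, hw⟩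

theorem quotientNFA_accepts (hsymm : ∀ a b, I a b → I b a) (E : RegularExpression α) :
    (quotientNFA (antimirovNFA I E) (weakSetoid I E)).accepts = traceSem I E := by
  ext w
  rw [NFA.accepts_eq_acceptsFrom_start, quotientNFA_mem_acceptsFrom hsymm]
  constructor
  · rintro ⟨p, ⟨q, hq, hqp⟩, hw⟩
    have h : WeakEq q.1 p.1 := Quotient.exact hqp
    rwa [← h.traceSem_eq, show q.1 = E from hq] at hw
  · exact fun hw => ⟨⟨E, [], .nil E⟩, ⟨_, rfl, rfl⟩, hw⟩

/-! ### Reorderable parts -/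

theorem restrSet_empty (E : RegularExpression α) : restrSet I ∅ E = E := by
  simp [restrSet, restrWord]

open Classical in
theorem restr_restrSet (a : α) (X : Finset α) (E : RegularExpression α) :
    restr I a (restrSet I X E) = restrSet I (insert a X) E := by
  have h : restr I a (restrWord I X.toList E) = restrWord I (X.toList ++ [a]) E := by
    simp [restrWord]
  rw [restrSet, h]
  exact restrWord_congr I _ _ (by simp [or_comm]) E

theorem restrSet_induction {P : RegularExpression α → RegularExpression α → Prop}
    (h0 : ∀ E, P E E) (h : ∀ a E F, P E F → P E (restr I a F)) (X : Finset α)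
    (E : RegularExpression α) : P E (restrSet I X E) := by
  classical
  induction X using Finset.induction_on with
  | empty => rw [restrSet_empty]; exact h0 E
  | insert a X _ ih => rw [← restr_restrSet]; exact h a _ _ ih

theorem restrSet_singleton (a : α) (E : RegularExpression α) :
    restrSet I {a} E = restr I a E := by
  simp [restrSet, restrWord]

theorem restr_comm (a b : α) (E : RegularExpression α) :
    restr I a (restr I b E) = restr I b (restr I a E) :=
  restrWord_congr I [b, a] [a, b] (by simp [or_comm]) E

theorem restrSet_star (X : Finset α) (E : RegularExpression α) :
    restrSet I X (star E) = star (restrSet I X E) := by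
  classical
  induction X using Finset.induction_on with
  | empty => simp only [restrSet_empty]
  | insert a X _ ih => simp only [← restr_restrSet, ih]; rfl

/-- The derivatives of the reorderable part are the reorderable parts of derivatives. -/
theorem PartDeriv.of_restr {E G : RegularExpression α} {a b : α}
    (h : PartDeriv I (restr I b E) a G) : ∃ E', PartDeriv I E a E' ∧ G = restr I b E' := by
  induction E generalizing G with
  | zero => exact (PartDeriv.zero_inv h).elim
  | epsilon => exact (PartDeriv.one_inv h).elim
  | char c =>
    rw [restr] at h
    split_ifs at h with hc
    · obtain ⟨rfl, rfl⟩ := partDeriv_char.1 h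
      exact ⟨1, .char _, rfl⟩
    · exact (PartDeriv.zero_inv h).elim
  | plus E F ihE ihF =>
    obtain h | h := partDeriv_add.1 h
    · obtain ⟨E', h', rfl⟩ := ihE h
      exact ⟨E', .add_left h', rfl⟩
    · obtain ⟨E', h', rfl⟩ := ihF h
      exact ⟨E', .add_right h', rfl⟩
  | comp E F ihE ihF =>
    obtain ⟨_, h₁, rfl⟩ | ⟨_, h₁, rfl⟩ := partDeriv_mul.1 h
    · obtain ⟨E', h', rfl⟩ := ihE h₁
      exact ⟨E' * F, .mul_left h', rfl⟩
    · obtain ⟨F', h', rfl⟩ := ihF h₁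
      exact ⟨restr I a E * F', .mul_right h', by rw [restr_comm]; rfl⟩
  | star E ih =>
    obtain ⟨_, h₁, rfl⟩ := partDeriv_star.1 h
    obtain ⟨E', h', rfl⟩ := ih h₁
    exact ⟨_, .star h', by rw [restr_comm]; rfl⟩

theorem PartDeriv.of_restrSet {E G : RegularExpression α} {a : α} {X : Finset α}
    (h : PartDeriv I (restrSet I X E) a G) :
    ∃ E', PartDeriv I E a E' ∧ G = restrSet I X E' := by
  classical
  induction X using Finset.induction_on generalizing G with
  | empty =>
    rw [restrSet_empty] at h
    exact ⟨G, h, (restrSet_empty G).symm⟩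
  | insert b X _ ih =>
    rw [← restr_restrSet] at h
    obtain ⟨G', h', rfl⟩ := h.of_restr
    obtain ⟨E', h'', rfl⟩ := ih h'
    exact ⟨E', h'', restr_restrSet b X E'⟩

theorem WeakEq.restr {E F : RegularExpression α} (h : WeakEq E F) (a : α) :
    WeakEq (restr I a E) (restr I a F) := by
  induction h with
  | refl => exact .refl _
  | symm _ ih => exact ih.symm
  | trans _ _ ih ih' => exact ih.trans ih'
  | add_congr _ _ ih ih' => exact .add_congr ih ih'
  | mul_congr _ _ ih ih' => exact .mul_congr ih ih'
  | star_congr _ ih => exact .star_congr ih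
  | mul_assoc => exact .mul_assoc _ _ _
  | one_mul => exact .one_mul _
  | mul_one => exact .mul_one _
  | zero_mul => exact .zero_mul _
  | mul_zero => exact .mul_zero _
  | zero_add_zero => exact .zero_add_zero
  | zero_add_one => exact .zero_add_one
  | one_add_zero => exact .one_add_zero
  | one_add_one => exact .one_add_one
  | star_zero => exact .star_zero
  | star_one => exact .star_one
  | star_mul_star => exact .star_mul_star _

theorem WeakEq.restrSet {E F : RegularExpression α} (h : WeakEq E F) (X : Finset α) :
    WeakEq (restrSet I X E) (restrSet I X F) := by
  classical
  induction X using Finset.induction_on with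
  | empty => simpa only [restrSet_empty] using h
  | insert a X _ ih => simpa only [← restr_restrSet] using ih.restr a

theorem matches'_restr_le (a : α) (E : RegularExpression α) :
    (restr I a E).matches' ≤ E.matches' := by
  induction E with
  | zero => exact le_rfl
  | epsilon => exact le_rfl
  | char b =>
    rw [restr]
    split_ifs
    exacts [le_rfl, bot_le]
  | plus E F ihE ihF => exact add_le_add ihE ihF
  | comp E F ihE ihF => exact mul_le_mul' ihE ihF
  | star E ih => exact kstar_mono ih

theorem matches'_restrSet_le (X : Finset α) (E : RegularExpression α) :
    (restrSet I X E).matches' ≤ E.matches' :=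
  restrSet_induction (P := fun E F => F.matches' ≤ E.matches') (fun _ => le_rfl)
    (fun a _ F h => (matches'_restr_le a F).trans h) X E

theorem indep_of_mem_matches'_restr {a b : α} {E : RegularExpression α} {w : List α}
    (hw : w ∈ (restr I a E).matches') (hb : b ∈ w) : I a b := by
  induction E generalizing w with
  | zero => cases hw
  | epsilon =>
    cases hw
    cases hb
  | char c =>
    rw [restr] at hw
    split_ifs at hw with h
    · cases hw
      rwa [List.mem_singleton.1 hb]
    · cases hw
  | plus E F ihE ihF => exact hw.elim (fun h => ihE h hb) (fun h => ihF h hb)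
  | comp E F ihE ihF =>
    obtain ⟨u, hu, v, hv, rfl⟩ := hw
    exact (List.mem_append.1 hb).elim (ihE hu) (ihF hv)
  | star E ih =>
    obtain ⟨L, rfl, hL⟩ := hw
    obtain ⟨u, hu, hbu⟩ := List.mem_flatten.1 hb
    exact ih (hL u hu) hbu

theorem indep_of_mem_matches'_restrSet {X : Finset α} {a b : α} (ha : a ∈ X)
    {E : RegularExpression α} {w : List α} (hw : w ∈ (restrSet I X E).matches') (hb : b ∈ w) :
    I a b := by
  classical
  rw [← Finset.insert_erase ha, ← restr_restrSet] at hw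
  exact indep_of_mem_matches'_restr hw hb

/-! ### Derivatives of sums and products -/

theorem PartDerivs.add_inv {E F G : RegularExpression α} {u : List α} (hu : u ≠ [])
    (h : PartDerivs I (E + F) u G) : PartDerivs I E u G ∨ PartDerivs I F u G := by
  obtain ⟨a, u, rfl⟩ := List.exists_cons_of_ne_nil hu
  obtain ⟨E', h1, h2⟩ := h.exists_cons rfl
  exact (partDeriv_add.1 h1).imp (fun h => h.partDerivs.trans h2) fun h => h.partDerivs.trans h2

/-- A derivative of `E * F` splits the word into the letters taken from `E` and those taken
from `F`; the set `X` consists of the latter. -/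
theorem PartDerivs.mul_inv {E F G : RegularExpression α} {u : List α}
    (h : PartDerivs I (E * F) u G) :
    ∃ (v w : List α) (X : Finset α) (E' F' : RegularExpression α),
      PartDerivs I E v E' ∧ PartDerivs I F w F' ∧ (∀ a, a ∈ X ↔ a ∈ w) ∧
      u.Perm (v ++ w) ∧ G = restrSet I X E' * F' := by
  classical
  induction h with
  | nil =>
    exact ⟨[], [], ∅, E, F, .nil E, .nil F, by simp, by simp, by rw [restrSet_empty]⟩
  | @snoc G G' u a h h' ih =>
    obtain ⟨v, w, X, E', F', hE, hF, hX, hu, rfl⟩ := ih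
    obtain ⟨E₁, h1, rfl⟩ | ⟨F₁, h1, rfl⟩ := partDeriv_mul.1 h'
    · obtain ⟨E₁, h2, rfl⟩ := h1.of_restrSet
      refine ⟨v ++ [a], w, X, E₁, F', hE.snoc h2, hF, hX, ?_, rfl⟩
      rw [List.append_assoc]
      refine (hu.append_right [a]).trans ?_
      rw [List.append_assoc]
      exact List.Perm.append_left v List.perm_append_comm
    · refine ⟨v, w ++ [a], insert a X, E', F₁, hE, hF.snoc h1, ?_, ?_, ?_⟩
      · simp [hX, or_comm]
      · simpa using hu.append_right [a]
      · rw [restr_restrSet]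

/-! ### Rebracketing products -/

/-- Equality of regular expressions up to the bracketing of top-level products. In contrast to
`WeakEq`, it relates only expressions with corresponding derivatives. -/
inductive AssocEq : RegularExpression α → RegularExpression α → Prop
  | refl (E : RegularExpression α) : AssocEq E E
  | symm {E F : RegularExpression α} : AssocEq E F → AssocEq F E
  | trans {E F G : RegularExpression α} : AssocEq E F → AssocEq F G → AssocEq E G
  | mul_congr {E E' F F' : RegularExpression α} :
      AssocEq E E' → AssocEq F F' → AssocEq (E * F) (E' * F')
  | mul_assoc (E F G : RegularExpression α) : AssocEq (E * F * G) (E * (F * G))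

theorem AssocEq.weakEq {E F : RegularExpression α} (h : AssocEq E F) : WeakEq E F := by
  induction h with
  | refl => exact .refl _
  | symm _ ih => exact ih.symm
  | trans _ _ ih ih' => exact ih.trans ih'
  | mul_congr _ _ ih ih' => exact .mul_congr ih ih'
  | mul_assoc => exact .mul_assoc _ _ _

theorem AssocEq.restr {E F : RegularExpression α} (h : AssocEq E F) (a : α) :
    AssocEq (restr I a E) (restr I a F) := by
  induction h with
  | refl => exact .refl _
  | symm _ ih => exact ih.symm
  | trans _ _ ih ih' => exact ih.trans ih'
  | mul_congr _ _ ih ih' => exact .mul_congr ih ih'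
  | mul_assoc => exact .mul_assoc _ _ _

/-- The two halves are proved together because of the constructor `symm`. -/
theorem AssocEq.bisim {E F : RegularExpression α} (h : AssocEq E F) (a : α) :
    (∀ E', PartDeriv I E a E' → ∃ F', PartDeriv I F a F' ∧ AssocEq E' F') ∧
    (∀ F', PartDeriv I F a F' → ∃ E', PartDeriv I E a E' ∧ AssocEq E' F') := by
  induction h with
  | refl => exact ⟨fun E' h => ⟨E', h, .refl _⟩, fun E' h => ⟨E', h, .refl _⟩⟩
  | symm _ ih =>
    refine ⟨fun E' h => ?_, fun E' h => ?_⟩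
    · obtain ⟨F', h1, h2⟩ := ih.2 E' h
      exact ⟨F', h1, h2.symm⟩
    · obtain ⟨F', h1, h2⟩ := ih.1 E' h
      exact ⟨F', h1, h2.symm⟩
  | trans _ _ ih ih' =>
    refine ⟨fun E' h => ?_, fun E' h => ?_⟩
    · obtain ⟨F', h1, h2⟩ := ih.1 E' h
      obtain ⟨G', h3, h4⟩ := ih'.1 F' h1
      exact ⟨G', h3, h2.trans h4⟩
    · obtain ⟨F', h1, h2⟩ := ih'.2 E' h
      obtain ⟨G', h3, h4⟩ := ih.2 F' h1
      exact ⟨G', h3, h4.trans h2⟩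
  | mul_congr hE hF ih ih' =>
    refine ⟨fun E' h => ?_, fun E' h => ?_⟩
    · obtain ⟨E₁, h1, rfl⟩ | ⟨F₁, h1, rfl⟩ := partDeriv_mul.1 h
      · obtain ⟨E₂, h2, h3⟩ := ih.1 _ h1
        exact ⟨_, .mul_left h2, h3.mul_congr hF⟩
      · obtain ⟨F₂, h2, h3⟩ := ih'.1 _ h1
        exact ⟨_, .mul_right h2, (hE.restr a).mul_congr h3⟩
    · obtain ⟨E₁, h1, rfl⟩ | ⟨F₁, h1, rfl⟩ := partDeriv_mul.1 h
      · obtain ⟨E₂, h2, h3⟩ := ih.2 _ h1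
        exact ⟨_, .mul_left h2, h3.mul_congr hF⟩
      · obtain ⟨F₂, h2, h3⟩ := ih'.2 _ h1
        exact ⟨_, .mul_right h2, (hE.restr a).mul_congr h3⟩
  | mul_assoc E F G =>
    refine ⟨fun E' h => ?_, fun E' h => ?_⟩
    · obtain ⟨H, h1, rfl⟩ | ⟨G₁, h1, rfl⟩ := partDeriv_mul.1 h
      · obtain ⟨E₁, h2, rfl⟩ | ⟨F₁, h2, rfl⟩ := partDeriv_mul.1 h1
        · exact ⟨_, .mul_left h2, .mul_assoc _ _ _⟩
        · exact ⟨_, .mul_right (.mul_left h2), .mul_assoc _ _ _⟩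
      · exact ⟨_, .mul_right (.mul_right h1), .mul_assoc _ _ _⟩
    · obtain ⟨E₁, h1, rfl⟩ | ⟨H, h1, rfl⟩ := partDeriv_mul.1 h
      · exact ⟨_, .mul_left (.mul_left h1), .mul_assoc _ _ _⟩
      · obtain ⟨F₁, h2, rfl⟩ | ⟨G₁, h2, rfl⟩ := partDeriv_mul.1 h1
        · exact ⟨_, .mul_left (.mul_right h2), .mul_assoc _ _ _⟩
        · exact ⟨_, .mul_right h2, .mul_assoc _ _ _⟩

/-! ### Derivatives of a star -/

/-- `StarHistory I E X₀ [(X₁, E₁), …, (Xₙ₋₁, Eₙ₋₁)] Eₙ` holds if `Xᵢ ⊆ Xᵢ₋₁` for `i < n` and each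
`Eᵢ` is a derivative of `E` along a nonempty word over `Xᵢ₋₁`. Star developments with such data are
the ones that arise as derivatives of `E*`; the constructors list them from the left. -/
inductive StarHistory (I : α → α → Prop) (E : RegularExpression α) :
    Finset α → List (Finset α × RegularExpression α) → RegularExpression α → Prop
  | last {X : Finset α} {u : List α} {En : RegularExpression α} :
      u ≠ [] → (∀ a ∈ u, a ∈ X) → PartDerivs I E u En → StarHistory I E X [] En
  | cons {X Y : Finset α} {u : List α} {F En : RegularExpression α}
      {l : List (Finset α × RegularExpression α)} :
      Y ⊆ X → u ≠ [] → (∀ a ∈ u, a ∈ X) → PartDerivs I E u F → StarHistory I E Y l En →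
      StarHistory I E X ((Y, F) :: l) En

theorem PartDeriv.of_star_restrSet {X : Finset α} {E G : RegularExpression α} {a : α}
    (h : PartDeriv I (restrSet I X E).star a G) :
    ∃ E', PartDeriv I E a E' ∧
      G = (restr I a (restrSet I X E)).star * (restrSet I X E' * (restrSet I X E).star) := by
  obtain ⟨_, h1, rfl⟩ := partDeriv_star.1 h
  obtain ⟨E', h2, rfl⟩ := h1.of_restrSet
  exact ⟨E', h2, rfl⟩

theorem AssocEq.mul_mul_mul (A B C D : RegularExpression α) :
    AssocEq (A * (B * C) * D) (A * (B * (C * D))) :=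
  (AssocEq.mul_assoc _ _ _).trans ((AssocEq.refl _).mul_congr (.mul_assoc _ _ _))

open Classical in
/-- The letter `a` is taken from one factor of the tail. It is added to the subalphabets of all
factors to the left, and if it is taken from a star, a new factor appears there. -/
theorem StarHistory.step_tail {E : RegularExpression α} {X : Finset α}
    {l : List (Finset α × RegularExpression α)} {En G : RegularExpression α} {a : α}
    (hl : StarHistory I E X l En) (h : PartDeriv I (starTail I E l En) a G) :
    ∃ l' En', StarHistory I E (insert a X) l' En' ∧ AssocEq G (starTail I E l' En') := by
  have mem_insert_of : ∀ {u : List α} {X : Finset α}, (∀ b ∈ u, b ∈ X) →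
      ∀ b ∈ u, b ∈ insert a X :=
    fun h b hb => Finset.mem_insert_of_mem (h b hb)
  have mem_snoc : ∀ {u : List α} {X : Finset α}, (∀ b ∈ u, b ∈ X) →
      ∀ b ∈ u ++ [a], b ∈ insert a X := by
    intro u X h b hb
    obtain hb | hb := List.mem_append.1 hb
    · exact Finset.mem_insert_of_mem (h b hb)
    · rw [List.mem_singleton.1 hb]
      exact Finset.mem_insert_self a X
  induction hl generalizing G with
  | @last X u En hu hX hE =>
    obtain ⟨E', h1, rfl⟩ | ⟨F', h1, rfl⟩ := partDeriv_mul.1 h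
    · exact ⟨[], E', .last (by simp) (mem_snoc hX) (hE.snoc h1), .refl _⟩
    · obtain ⟨E', h2, rfl⟩ := partDeriv_star.1 h1
      refine ⟨[({a}, En)], E', .cons (by simp) hu (mem_insert_of hX) hE
        (.last (by simp) (by simp) h2.partDerivs), ?_⟩
      simp only [starTail, restrSet_singleton]
      exact .refl _
  | @cons X Y u F En l hYX hu hX hF hl ih =>
    obtain ⟨_, h1, rfl⟩ | ⟨_, h1, rfl⟩ := partDeriv_mul.1 h
    · obtain ⟨F', h2, rfl⟩ := h1.of_restrSet
      exact ⟨(Y, F') :: l, En, .cons (hYX.trans (Finset.subset_insert _ _)) (by simp)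
        (mem_snoc hX) (hF.snoc h2) hl, .refl _⟩
    · obtain ⟨_, h2, rfl⟩ | ⟨_, h2, rfl⟩ := partDeriv_mul.1 h1
      · obtain ⟨E', h3, rfl⟩ := h2.of_star_restrSet
        refine ⟨(insert a Y, F) :: (Y, E') :: l, En,
          .cons (Finset.insert_subset_insert a hYX) hu (mem_insert_of hX) hF
            (.cons (Finset.subset_insert _ _) (by simp) (by simp) h3.partDerivs hl), ?_⟩
        simp only [starTail, restr_restrSet]
        exact (AssocEq.refl _).mul_congr (.mul_mul_mul _ _ _ _)
      · obtain ⟨l', En', h3, h4⟩ := ih h2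
        refine ⟨(insert a Y, F) :: l', En',
          .cons (Finset.insert_subset_insert a hYX) hu (mem_insert_of hX) hF h3, ?_⟩
        simp only [starTail, restr_restrSet, ← restrSet_star]
        exact (AssocEq.refl _).mul_congr ((AssocEq.refl _).mul_congr h4)

open Classical in
theorem StarHistory.step {E : RegularExpression α} {X : Finset α}
    {l : List (Finset α × RegularExpression α)} {En G : RegularExpression α} {a : α}
    (hl : StarHistory I E X l En) (h : PartDeriv I (starDev I E X l En) a G) :
    ∃ l' En', StarHistory I E (insert a X) l' En' ∧
      AssocEq G (starDev I E (insert a X) l' En') := by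
  obtain ⟨_, h2, rfl⟩ | ⟨_, h2, rfl⟩ := partDeriv_mul.1 h
  · obtain ⟨E', h3, rfl⟩ := h2.of_star_restrSet
    refine ⟨(X, E') :: l, En,
      .cons (Finset.subset_insert _ _) (by simp) (by simp) h3.partDerivs hl, ?_⟩
    simp only [starDev, starTail, restr_restrSet]
    exact .mul_mul_mul _ _ _ _
  · obtain ⟨l', En', h3, h4⟩ := hl.step_tail h2
    refine ⟨l', En', h3, ?_⟩
    simp only [starDev, ← restr_restrSet]
    exact (AssocEq.refl _).mul_congr h4

/-- Every derivative of `E*` along a nonempty word is a star development, up to bracketing. -/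
theorem PartDerivs.star_inv {E G : RegularExpression α} {u : List α} (hu : u ≠ [])
    (h : PartDerivs I (star E) u G) :
    ∃ X l En, StarHistory I E X l En ∧ AssocEq G (starDev I E X l En) := by
  classical
  induction h with
  | nil => exact absurd rfl hu
  | @snoc G G' u a h h' ih =>
    by_cases hu' : u = []
    · cases h.eq_of_nil hu'
      obtain ⟨E', h1, rfl⟩ := partDeriv_star.1 h'
      refine ⟨{a}, [], E', .last (by simp) (by simp) h1.partDerivs, ?_⟩
      rw [starDev, starTail, restrSet_singleton]
      exact .refl _
    · obtain ⟨X, l, En, h1, h2⟩ := ih hu'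
      obtain ⟨H, h3, h4⟩ := (h2.bisim a).1 _ h'
      obtain ⟨l', En', h5, h6⟩ := h1.step h3
      exact ⟨_, l', En', h5, h4.trans h6⟩

theorem StarHistory.nonempty {E : RegularExpression α} {X : Finset α}
    {l : List (Finset α × RegularExpression α)} {En : RegularExpression α}
    (hl : StarHistory I E X l En) : X.Nonempty := by
  cases hl with
  | @last _ u _ hu hX _ =>
    obtain ⟨a, ha⟩ := List.exists_mem_of_ne_nil u hu
    exact ⟨a, hX a ha⟩
  | @cons _ _ u _ _ _ _ hu hX _ _ =>
    obtain ⟨a, ha⟩ := List.exists_mem_of_ne_nil u hu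
    exact ⟨a, hX a ha⟩

theorem starTail_congr {E : RegularExpression α}
    {l l' : List (Finset α × RegularExpression α)} {En En' : RegularExpression α}
    (hl : List.Forall₂ (fun p q => p.1 = q.1 ∧ WeakEq p.2 q.2) l l') (hE : WeakEq En En') :
    WeakEq (starTail I E l En) (starTail I E l' En') := by
  induction hl with
  | nil => exact hE.mul_congr (.refl _)
  | @cons p q _ _ h _ ih =>
    obtain ⟨X, F⟩ := p
    obtain ⟨_, F'⟩ := q
    obtain ⟨rfl, hF⟩ := h
    exact (hF.restrSet X).mul_congr ((WeakEq.refl _).mul_congr ih)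

theorem starDev_congr {E : RegularExpression α} (X : Finset α)
    {l l' : List (Finset α × RegularExpression α)} {En En' : RegularExpression α}
    (hl : List.Forall₂ (fun p q => p.1 = q.1 ∧ WeakEq p.2 q.2) l l') (hE : WeakEq En En') :
    WeakEq (starDev I E X l En) (starDev I E X l' En') :=
  (WeakEq.refl _).mul_congr (starTail_congr hl hE)

/-! ### Every derivative lies in `E^{→*}` modulo the theory -/

theorem StarHistory.exists_succPlus {E : RegularExpression α}
    (hE : ∀ (E' : RegularExpression α) (u : List α), u ≠ [] → PartDerivs I E u E' →
      ∃ E'' ∈ succPlus I E, WeakEq E' E'')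
    {X : Finset α} {l : List (Finset α × RegularExpression α)} {En : RegularExpression α}
    (hl : StarHistory I E X l En) :
    ∃ l' En', List.Forall₂ (fun p q => p.1 = q.1 ∧ WeakEq p.2 q.2) l l' ∧ WeakEq En En' ∧
      (∀ p ∈ l', p.1.Nonempty ∧ p.2 ∈ succPlus I E) ∧ En' ∈ succPlus I E ∧
      List.IsChain (fun X Y => Y ⊆ X) (X :: l'.map Prod.fst) := by
  induction hl with
  | last hu _ h =>
    obtain ⟨En', h1, h2⟩ := hE _ _ hu h
    exact ⟨[], En', .nil, h2, by simp, h1, by simp⟩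
  | @cons X Y u F En l hYX hu _ hF hl ih =>
    obtain ⟨F', h1, h2⟩ := hE _ _ hu hF
    obtain ⟨l', En', h3, h4, h5, h6, h7⟩ := ih
    refine ⟨(Y, F') :: l', En', .cons ⟨rfl, h2⟩ h3, h4, ?_, h6, ?_⟩
    · rintro p (_ | ⟨_, hp⟩)
      exacts [⟨hl.nonempty, h1⟩, h5 p hp]
    · exact List.isChain_cons_cons.2 ⟨hYX, h7⟩

theorem PartDerivs.exists_succPlus {E G : RegularExpression α} {u : List α} (hu : u ≠ [])
    (h : PartDerivs I E u G) : ∃ G' ∈ succPlus I E, WeakEq G G' := by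
  induction E generalizing G u with
  | zero =>
    obtain ⟨a, u, rfl⟩ := List.exists_cons_of_ne_nil hu
    obtain ⟨E', h1, -⟩ := h.exists_cons rfl
    exact (PartDeriv.zero_inv h1).elim
  | epsilon =>
    obtain ⟨a, u, rfl⟩ := List.exists_cons_of_ne_nil hu
    obtain ⟨E', h1, -⟩ := h.exists_cons rfl
    exact (PartDeriv.one_inv h1).elim
  | char b =>
    obtain ⟨a, u, rfl⟩ := List.exists_cons_of_ne_nil hu
    obtain ⟨E', h1, h2⟩ := h.exists_cons rfl
    obtain ⟨rfl, rfl⟩ := partDeriv_char.1 h1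
    cases u with
    | nil =>
      cases h2.eq_of_nil rfl
      exact ⟨1, rfl, .refl _⟩
    | cons b u =>
      obtain ⟨E'', h3, -⟩ := h2.exists_cons rfl
      exact (PartDeriv.one_inv h3).elim
  | plus E F ihE ihF =>
    obtain h | h := PartDerivs.add_inv hu h
    · obtain ⟨G', h1, h2⟩ := ihE hu h
      exact ⟨G', .inl h1, h2⟩
    · obtain ⟨G', h1, h2⟩ := ihF hu h
      exact ⟨G', .inr h1, h2⟩
  | comp E F ihE ihF =>
    obtain ⟨v, w, X, E', F', hE, hF, hX, hperm, rfl⟩ := PartDerivs.mul_inv h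
    by_cases hw : w = []
    · cases hF.eq_of_nil hw
      have hX0 : X = ∅ := Finset.eq_empty_of_forall_notMem (by simp [hX, hw])
      have hv : v ≠ [] := by
        rintro rfl
        subst hw
        exact hu hperm.eq_nil
      obtain ⟨E'', h1, h2⟩ := ihE hv hE
      refine ⟨E'' * F, .inl ⟨E'', h1, rfl⟩, ?_⟩
      rw [hX0, restrSet_empty]
      exact h2.mul_congr (.refl _)
    · obtain ⟨F'', h1, h2⟩ := ihF hw hF
      have hX0 : X.Nonempty := by
        obtain ⟨a, ha⟩ := List.exists_mem_of_ne_nil w hw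
        exact ⟨a, (hX a).2 ha⟩
      have h3 : ∃ E'' ∈ ({E} ∪ succPlus I E : Set (RegularExpression α)), WeakEq E' E'' := by
        by_cases hv : v = []
        · cases hE.eq_of_nil hv
          exact ⟨E, .inl rfl, .refl _⟩
        · obtain ⟨E'', h1, h2⟩ := ihE hv hE
          exact ⟨E'', .inr h1, h2⟩
      obtain ⟨E'', h4, h5⟩ := h3
      exact ⟨_, .inr ⟨X, hX0, E'', h4, F'', h1, rfl⟩, (h5.restrSet X).mul_congr h2⟩
  | star E ih =>
    obtain ⟨X, l, En, h1, h2⟩ := PartDerivs.star_inv hu h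
    obtain ⟨l', En', h3, h4, h5, h6, h7⟩ := h1.exists_succPlus fun _ _ hu h => ih hu h
    exact ⟨_, ⟨X, l', En', h1.nonempty, h5, h6, h7, rfl⟩, h2.weakEq.trans (starDev_congr X h3 h4)⟩

/-! ### Merging star developments under connectedness -/

/-- A nonempty word of a connected language cannot be split into two nonempty independent parts. -/
theorem WordConnected.eq_nil_or_eq_nil (hirr : ∀ a, ¬ I a a) (hsymm : ∀ a b, I a b → I b a)
    {u v w : List α} (hw : WordConnected I w) (hp : w.Perm (u ++ v)) (huv : WordIndep I u v) :
    u = [] ∨ v = [] := by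
  by_contra! h
  obtain ⟨a, ha⟩ := List.exists_mem_of_ne_nil u h.1
  obtain ⟨b, hb⟩ := List.exists_mem_of_ne_nil v h.2
  have hmem : ∀ i, w.get i ∈ u ∨ w.get i ∈ v := fun i =>
    List.mem_append.1 (hp.mem_iff.1 (List.get_mem w i))
  -- membership of the letter in `u` is constant along the edges of the dependence graph
  have hadj : ∀ i j, (dependenceGraph I w).Adj i j → w.get i ∈ u → w.get j ∈ u := by
    intro i j hij hi
    refine (hmem j).resolve_right fun hj => ?_
    have hI := huv _ hi _ hj
    obtain ⟨-, h | h⟩ := (SimpleGraph.fromRel_adj _ _ _).1 hij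
    · exact h.2 hI
    · exact h.2 (hsymm _ _ hI)
  have hreach : ∀ i j, (dependenceGraph I w).Walk i j → w.get i ∈ u → w.get j ∈ u := by
    intro i j p
    induction p with
    | nil => exact id
    | cons h _ ih => exact fun hi => ih (hadj _ _ h hi)
  obtain ⟨i, hi⟩ := List.mem_iff_get.1 (hp.mem_iff.2 (List.mem_append_left v ha))
  obtain ⟨j, hj⟩ := List.mem_iff_get.1 (hp.mem_iff.2 (List.mem_append_right u hb))
  obtain ⟨p⟩ := hw i j
  have hbu : b ∈ u := hj ▸ hreach i j p (hi ▸ ha)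
  exact hirr b (huv b hbu b hb)

/-- The words of a derivative of `E` along `a` arise from words of `E` by deleting an `a`, not
necessarily the first letter. -/
theorem PartDeriv.exists_perm {E E' : RegularExpression α} {a : α} (h : PartDeriv I E a E')
    {v : List α} (hv : v ∈ E'.matches') : ∃ w ∈ E.matches', w.Perm (a :: v) := by
  induction h generalizing v with
  | char a =>
    cases hv
    exact ⟨[a], rfl, .refl _⟩
  | add_left _ ih =>
    obtain ⟨w, h1, h2⟩ := ih hv
    exact ⟨w, .inl h1, h2⟩
  | add_right _ ih =>
    obtain ⟨w, h1, h2⟩ := ih hv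
    exact ⟨w, .inr h1, h2⟩
  | mul_left _ ih =>
    obtain ⟨x, hx, y, hy, rfl⟩ := hv
    obtain ⟨w, h1, h2⟩ := ih hx
    exact ⟨w ++ y, ⟨w, h1, y, hy, rfl⟩, h2.append_right y⟩
  | @mul_right E F F' a _ ih =>
    obtain ⟨x, hx, y, hy, rfl⟩ := hv
    obtain ⟨w, h1, h2⟩ := ih hy
    exact ⟨x ++ w, ⟨x, matches'_restr_le a E hx, w, h1, rfl⟩,
      (h2.append_left x).trans List.perm_middle⟩
  | @star E E' a _ ih =>
    obtain ⟨x, hx, _, ⟨y, hy, z, hz, rfl⟩, rfl⟩ := hv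
    obtain ⟨w, h1, h2⟩ := ih hy
    obtain ⟨lx, rfl, hlx⟩ := matches'_restr_le a (RegularExpression.star E) hx
    obtain ⟨lz, rfl, hlz⟩ := hz
    refine ⟨lx.flatten ++ (w ++ lz.flatten), ⟨lx ++ w :: lz, by simp, ?_⟩,
      (List.Perm.append_left _ (h2.append_right _)).trans List.perm_middle⟩
    intro y hy
    simp only [List.mem_append, List.mem_cons] at hy
    obtain hy | rfl | hy := hy
    exacts [hlx y hy, h1, hlz y hy]

theorem PartDerivs.exists_perm {E E' : RegularExpression α} {u : List α}
    (h : PartDerivs I E u E') {v : List α} (hv : v ∈ E'.matches') :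
    ∃ w ∈ E.matches', w.Perm (u ++ v) := by
  induction h generalizing v with
  | nil => exact ⟨v, hv, .refl _⟩
  | snoc _ h ih =>
    obtain ⟨w, h1, h2⟩ := h.exists_perm hv
    obtain ⟨w', h3, h4⟩ := ih h1
    exact ⟨w', h3, by simpa using h4.trans (h2.append_left _)⟩

theorem weakEq_zero_or_one_add {E F : RegularExpression α} : WeakEq E 0 ∨ WeakEq E 1 →
    WeakEq F 0 ∨ WeakEq F 1 → WeakEq (E + F) 0 ∨ WeakEq (E + F) 1
  | .inl h, .inl h' => .inl ((h.add_congr h').trans .zero_add_zero)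
  | .inl h, .inr h' => .inr ((h.add_congr h').trans .zero_add_one)
  | .inr h, .inl h' => .inr ((h.add_congr h').trans .one_add_zero)
  | .inr h, .inr h' => .inr ((h.add_congr h').trans .one_add_one)

/-- The theory is complete for expressions without nonempty words. -/
theorem weakEq_zero_or_one_of_matches'_le_one {E : RegularExpression α}
    (h : E.matches' ≤ 1) : WeakEq E 0 ∨ WeakEq E 1 := by
  induction E with
  | zero => exact .inl (.refl _)
  | epsilon => exact .inr (.refl _)
  | char a => exact absurd ((Language.mem_one _).1 (h (rfl : [a] ∈ ({[a]} : Language α)))) (by simp)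
  | plus E F ihE ihF =>
    exact weakEq_zero_or_one_add (ihE fun _ hw => h (.inl hw)) (ihF fun _ hw => h (.inr hw))
  | comp E F ihE ihF =>
    have hzero : ∀ G : RegularExpression α, (∀ w, w ∉ G.matches') →
        (G.matches' ≤ 1 → WeakEq G 0 ∨ WeakEq G 1) → WeakEq G 0 := by
      intro G hG h
      refine (h fun w hw => (hG w hw).elim).resolve_right fun h1 => ?_
      have := hG []
      rw [h1.matches'_eq] at this
      exact this Language.nil_mem_one
    by_cases hE : ∀ w, w ∉ E.matches'
    · exact .inl (((hzero E hE ihE).mul_congr (.refl F)).trans (.zero_mul F))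
    by_cases hF : ∀ w, w ∉ F.matches'
    · exact .inl (((WeakEq.refl E).mul_congr (hzero F hF ihF)).trans (.mul_zero E))
    push Not at hE hF
    obtain ⟨x, hx⟩ := hE
    obtain ⟨y, hy⟩ := hF
    have hnil : ∀ u ∈ E.matches', ∀ v ∈ F.matches', u = [] ∧ v = [] := fun u hu v hv =>
      List.append_eq_nil_iff.1 ((Language.mem_one _).1 (h ⟨u, hu, v, hv, rfl⟩))
    obtain h1 | h1 := ihE fun u hu => (Language.mem_one u).2 (hnil u hu y hy).1
    · exact .inl ((h1.mul_congr (.refl F)).trans (.zero_mul F))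
    obtain h2 | h2 := ihF fun v hv => (Language.mem_one v).2 (hnil x hx v hv).2
    · exact .inl (((WeakEq.refl E).mul_congr h2).trans (.mul_zero E))
    · exact .inr ((h1.mul_congr h2).trans (.one_mul 1))
  | star E ih =>
    obtain h1 | h1 := ih (le_trans le_kstar h)
    · exact .inr (h1.star_congr.trans .star_zero)
    · exact .inr (h1.star_congr.trans .star_one)

/-- If `E` is connected and `F` is a derivative of `E` along a nonempty word over `X`, then the
words of `R_X F` are independent of that word, hence empty. -/
theorem restrSet_weakEq_zero_or_one (hirr : ∀ a, ¬ I a a) (hsymm : ∀ a b, I a b → I b a)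
    {E F : RegularExpression α} (hE : LangConnected I E.matches') {u : List α} (hu : u ≠ [])
    {X : Finset α} (hX : ∀ a ∈ u, a ∈ X) (h : PartDerivs I E u F) :
    WeakEq (restrSet I X F) 0 ∨ WeakEq (restrSet I X F) 1 := by
  refine weakEq_zero_or_one_of_matches'_le_one fun v hv => (Language.mem_one v).2 ?_
  obtain ⟨w, hw, hp⟩ := h.exists_perm (matches'_restrSet_le X F hv)
  refine ((hE w hw).eq_nil_or_eq_nil hirr hsymm hp ?_).resolve_left hu
  exact fun a ha b hb => indep_of_mem_matches'_restrSet (hX a ha) hv hb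

/-- When `Xᵢ₋₁ = Xᵢ`, the factor `R_{Xᵢ} Eᵢ` is `0` or `1` in the theory: it either annihilates
the development, or it vanishes and the two equal stars around it merge. -/
theorem StarHistory.exists_strict (hirr : ∀ a, ¬ I a a) (hsymm : ∀ a b, I a b → I b a)
    {E : RegularExpression α} (hE : LangConnected I E.matches') {X : Finset α}
    {l : List (Finset α × RegularExpression α)} {En : RegularExpression α}
    (hl : StarHistory I E X l En) :
    WeakEq (starDev I E X l En) 0 ∨
    ∃ l' En', (∀ Y ∈ X :: l'.map Prod.fst, Y.Nonempty) ∧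
      List.IsChain (fun X Y => Y ⊂ X) (X :: l'.map Prod.fst) ∧
      (∀ F ∈ En' :: l'.map Prod.snd, ∃ v : List α, v ≠ [] ∧ PartDerivs I E v F) ∧
      WeakEq (starDev I E X l En) (starDev I E X l' En') := by
  induction hl with
  | @last X u En hu hX h =>
    obtain ⟨a, ha⟩ := List.exists_mem_of_ne_nil u hu
    have hne : X.Nonempty := ⟨a, hX a ha⟩
    exact .inr ⟨[], En, by simpa using hne, by simp, by simpa using ⟨u, hu, h⟩, .refl _⟩
  | @cons X Y u F En l hYX hu hX hF hl ih =>
    have hne := (StarHistory.cons hYX hu hX hF hl).nonempty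
    have hdev : ∀ l En, starDev I E X ((Y, F) :: l) En =
        star (restrSet I X E) * (restrSet I Y F * starDev I E Y l En) := fun _ _ => rfl
    obtain h0 | ⟨l', En', h1, h2, h3, h4⟩ := ih
    · left
      rw [hdev]
      refine ((WeakEq.refl _).mul_congr ?_).trans (.mul_zero _)
      exact ((WeakEq.refl _).mul_congr h0).trans (.mul_zero _)
    obtain rfl | hlt := eq_or_ssubset_of_subset hYX
    · obtain h5 | h5 := restrSet_weakEq_zero_or_one hirr hsymm hE hu hX hF
      · left
        rw [hdev]
        refine ((WeakEq.refl _).mul_congr ?_).trans (.mul_zero _)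
        exact (h5.mul_congr (.refl _)).trans (.zero_mul _)
      · refine .inr ⟨l', En', h1, h2, h3, ?_⟩
        rw [hdev]
        refine ((WeakEq.refl _).mul_congr ((h5.mul_congr h4).trans (.one_mul _))).trans ?_
        exact (WeakEq.mul_assoc _ _ _).symm.trans ((WeakEq.star_mul_star _).mul_congr (.refl _))
    · refine .inr ⟨(Y, F) :: l', En', ?_, List.isChain_cons_cons.2 ⟨hlt, h2⟩, ?_, ?_⟩
      · exact List.forall_mem_cons.2 ⟨hne, h1⟩
      · simp only [List.map_cons, List.mem_cons, forall_eq_or_imp] at h3 ⊢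
        exact ⟨h3.1, ⟨u, hu, hF⟩, h3.2⟩
      · rw [hdev, hdev]
        exact (WeakEq.refl _).mul_congr ((WeakEq.refl _).mul_congr h4)

theorem length_le_card_of_isChain_ssubset {X : Finset α} {l : List (Finset α)}
    (h : ∀ Y ∈ X :: l, Y.Nonempty) (hl : List.IsChain (fun X Y => Y ⊂ X) (X :: l)) :
    l.length + 1 ≤ X.card := by
  induction l generalizing X with
  | nil => simpa using h
  | cons Y l ih =>
    obtain ⟨h1, h2⟩ := List.isChain_cons_cons.1 hl
    have h3 := ih (fun Z hZ => h Z (List.mem_cons_of_mem _ hZ)) h2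
    have h4 := Finset.card_lt_card h1
    simp only [List.length_cons]
    omega

theorem PartDerivs.star_inv_of_connected [Fintype α] (hirr : ∀ a, ¬ I a a)
    (hsymm : ∀ a b, I a b → I b a) {E E' : RegularExpression α} {u : List α}
    (hE : LangConnected I E.matches') (h : PartDerivs I (star E) u E') :
    (u = [] ∧ E' = star E) ∨
      ∃ (X₀ : Finset α) (l : List (Finset α × RegularExpression α)) (En : RegularExpression α),
        l.length + 1 ≤ Fintype.card α ∧
        (∀ X ∈ X₀ :: l.map Prod.fst, X.Nonempty) ∧
        List.IsChain (fun X Y => Y ⊂ X) (X₀ :: l.map Prod.fst) ∧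
        (∀ F ∈ En :: l.map Prod.snd, F = 0 ∨ ∃ v : List α, v ≠ [] ∧ PartDerivs I E v F) ∧
        WeakEq E' (starDev I E X₀ l En) := by
  by_cases hu : u = []
  · exact .inl ⟨hu, h.eq_of_nil hu⟩
  right
  obtain ⟨X, l, En, h1, h2⟩ := PartDerivs.star_inv hu h
  obtain h0 | ⟨l', En', h3, h4, h5, h6⟩ := h1.exists_strict hirr hsymm hE
  · -- an annihilated development is represented by `(R_X E)* 0 E*`
    have hX := h1.nonempty
    refine ⟨X, [], 0, ?_, by simpa using hX, by simp, by simp, ?_⟩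
    · exact Fintype.card_pos_iff.2 ⟨hX.choose⟩
    · refine (h2.weakEq.trans h0).trans (WeakEq.symm ?_)
      exact ((WeakEq.refl _).mul_congr (.zero_mul _)).trans (.mul_zero _)
  · refine ⟨X, l', En', ?_, h3, h4, fun F hF => .inr (h5 F hF), h2.weakEq.trans h6⟩
    have := length_le_card_of_isChain_ssubset h3 h4
    rw [List.length_map] at this
    exact this.trans (Finset.card_le_univ X)

/-! ### Finiteness -/

/-- Finitely many expressions represent all derivatives of `E` modulo the theory. -/
def FiniteDerivs (I : α → α → Prop) (E : RegularExpression α) : Prop :=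
  ∃ S : Set (RegularExpression α), S.Finite ∧
    ∀ (u : List α) (E' : RegularExpression α), PartDerivs I E u E' → ∃ F ∈ S, WeakEq E' F

theorem FiniteDerivs.of_char (a : α) : FiniteDerivs I (char a) := by
  refine ⟨{char a, 1}, Set.toFinite _, fun u E' h => ?_⟩
  by_cases hu : u = []
  · exact ⟨_, by simp [h.eq_of_nil hu], .refl _⟩
  · obtain ⟨F, hF, h'⟩ := h.exists_succPlus hu
    exact ⟨F, .inr hF, h'⟩

theorem FiniteDerivs.of_succPlus_eq_empty {E : RegularExpression α} (hE : succPlus I E = ∅) :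
    FiniteDerivs I E := by
  refine ⟨{E}, Set.toFinite _, fun u E' h => ?_⟩
  by_cases hu : u = []
  · exact ⟨_, by simp [h.eq_of_nil hu], .refl _⟩
  · obtain ⟨F, hF, -⟩ := h.exists_succPlus hu
    simp [hE] at hF

theorem FiniteDerivs.add {E F : RegularExpression α} (hE : FiniteDerivs I E)
    (hF : FiniteDerivs I F) : FiniteDerivs I (E + F) := by
  obtain ⟨S, hS, hE⟩ := hE
  obtain ⟨T, hT, hF⟩ := hF
  refine ⟨{E + F} ∪ (S ∪ T), (Set.finite_singleton _).union (hS.union hT), fun u G h => ?_⟩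
  by_cases hu : u = []
  · exact ⟨_, .inl rfl, by rw [h.eq_of_nil hu]; exact .refl _⟩
  · obtain h | h := PartDerivs.add_inv hu h
    · obtain ⟨G', h1, h2⟩ := hE _ _ h
      exact ⟨G', .inr (.inl h1), h2⟩
    · obtain ⟨G', h1, h2⟩ := hF _ _ h
      exact ⟨G', .inr (.inr h1), h2⟩

theorem FiniteDerivs.mul [Finite α] {E F : RegularExpression α} (hE : FiniteDerivs I E)
    (hF : FiniteDerivs I F) : FiniteDerivs I (E * F) := by
  obtain ⟨S, hS, hE⟩ := hE
  obtain ⟨T, hT, hF⟩ := hF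
  refine ⟨(fun p : Finset α × RegularExpression α × RegularExpression α =>
      restrSet I p.1 p.2.1 * p.2.2) '' (Set.univ ×ˢ S ×ˢ T),
    (Set.finite_univ.prod (hS.prod hT)).image _, fun u G h => ?_⟩
  obtain ⟨v, w, X, E', F', h1, h2, -, -, rfl⟩ := PartDerivs.mul_inv h
  obtain ⟨E'', h3, h4⟩ := hE _ _ h1
  obtain ⟨F'', h5, h6⟩ := hF _ _ h2
  exact ⟨_, ⟨(X, E'', F''), ⟨trivial, h3, h5⟩, rfl⟩, (h4.restrSet X).mul_congr h6⟩

theorem FiniteDerivs.star [Finite α] (hirr : ∀ a, ¬ I a a) (hsymm : ∀ a b, I a b → I b a)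
    {E : RegularExpression α} (hE : FiniteDerivs I E) (hconn : LangConnected I E.matches') :
    FiniteDerivs I (.star E) := by
  have := Fintype.ofFinite α
  obtain ⟨S, hS, hE⟩ := hE
  have hS' : (insert 0 S).Finite := hS.insert 0
  have := hS'.to_subtype
  let f : Finset α × List (Finset α × ↥(insert 0 S)) × ↥(insert 0 S) → RegularExpression α :=
    fun p => starDev I E p.1 (p.2.1.map fun q => (q.1, q.2.1)) p.2.2
  let D : Set (Finset α × List (Finset α × ↥(insert 0 S)) × ↥(insert 0 S)) :=
    Set.univ ×ˢ {l | l.length ≤ Fintype.card α} ×ˢ Set.univ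
  have hD : D.Finite :=
    Set.finite_univ.prod ((List.finite_length_le _ _).prod Set.finite_univ)
  refine ⟨{.star E} ∪ f '' D, (Set.finite_singleton _).union (hD.image f), fun u G h => ?_⟩
  obtain ⟨-, rfl⟩ | ⟨X, l, En, h1, -, -, h2, h3⟩ := h.star_inv_of_connected hirr hsymm hconn
  · exact ⟨_, .inl rfl, .refl _⟩
  have hrep : ∀ F ∈ En :: l.map Prod.snd, ∃ F' : ↥(insert 0 S), WeakEq F F'.1 := by
    intro F hF
    obtain rfl | ⟨v, -, hv⟩ := h2 F hF
    · exact ⟨⟨0, .inl rfl⟩, .refl _⟩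
    · obtain ⟨F', h4, h5⟩ := hE _ _ hv
      exact ⟨⟨F', .inr h4⟩, h5⟩
  obtain ⟨En', hEn⟩ := hrep En (by simp)
  have hl : ∃ l' : List (Finset α × ↥(insert 0 S)), l'.length = l.length ∧
      List.Forall₂ (fun p q => p.1 = q.1 ∧ WeakEq p.2 q.2) l
        (l'.map fun q => (q.1, q.2.1)) := by
    have hrep' : ∀ p ∈ l, ∃ F' : ↥(insert 0 S), WeakEq p.2 F'.1 := fun p hp =>
      hrep p.2 (List.mem_cons_of_mem _ (List.mem_map_of_mem hp))
    clear h1 h2 h3 hrep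
    induction l with
    | nil => exact ⟨[], rfl, .nil⟩
    | cons p l ih =>
      obtain ⟨l', h4, h5⟩ := ih fun q hq => hrep' q (List.mem_cons_of_mem _ hq)
      obtain ⟨F', h6⟩ := hrep' p (by simp)
      exact ⟨(p.1, F') :: l', by simp [h4], .cons ⟨rfl, h6⟩ h5⟩
  obtain ⟨l', h4, h5⟩ := hl
  refine ⟨_, .inr ⟨(X, l', En'), ⟨trivial, ?_, trivial⟩, rfl⟩, h3.trans (starDev_congr X h5 hEn)⟩
  change l'.length ≤ _
  omega

theorem StarConnected.finiteDerivs [Finite α] (hirr : ∀ a, ¬ I a a)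
    (hsymm : ∀ a b, I a b → I b a) {E : RegularExpression α} (h : StarConnected I E) :
    FiniteDerivs I E := by
  induction h with
  | zero => exact .of_succPlus_eq_empty rfl
  | one => exact .of_succPlus_eq_empty rfl
  | char a => exact .of_char a
  | add _ _ ihE ihF => exact ihE.add ihF
  | mul _ _ ihE ihF => exact ihE.mul ihF
  | star _ hconn ih => exact ih.star hirr hsymm hconn

theorem FiniteDerivs.finite_quotient {E : RegularExpression α} (h : FiniteDerivs I E) :
    Finite (Quotient (weakSetoid I E)) := by
  obtain ⟨S, hS, hE⟩ := h
  have := hS.to_subtype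
  have hrep : ∀ c : Quotient (weakSetoid I E), ∃ F : S, WeakEq c.out.1 F.1 := by
    intro c
    obtain ⟨u, hu⟩ := c.out.2
    obtain ⟨F, h1, h2⟩ := hE _ _ hu
    exact ⟨⟨F, h1⟩, h2⟩
  choose f hf using hrep
  refine Finite.of_injective f fun c d hcd => ?_
  rw [← c.out_eq, ← d.out_eq]
  refine Quotient.sound (?_ : WeakEq c.out.1 d.out.1)
  exact (hf c).trans (hcd ▸ (hf d).symm)

end TraceRegex

end

open TraceRegex
theorem mainTheorem4 {α : Type*} [Fintype α] (I : α → α → Prop)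
    (hirr : ∀ a, ¬ I a a) (hsymm : ∀ a b, I a b → I b a) :
    -- the weak equational theory is sound
    (∀ E F : RegularExpression α, WeakEq E F → E.matches' = F.matches') ∧
    -- parts-of-derivatives of `E` are in `E^{→*}` modulo the theory
    (∀ (E E' : RegularExpression α) (u : List α), PartDerivs I E u E' →
      ∃ E'' ∈ succStar I E, WeakEq E' E'') ∧
    -- star-derivatives under connectedness
    (∀ (E E' : RegularExpression α) (u : List α), LangConnected I E.matches' →
      PartDerivs I (RegularExpression.star E) u E' →
      (u = [] ∧ E' = RegularExpression.star E) ∨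
      ∃ (X₀ : Finset α) (l : List (Finset α × RegularExpression α)) (En : RegularExpression α),
        l.length + 1 ≤ Fintype.card α ∧
        (∀ X ∈ X₀ :: l.map Prod.fst, X.Nonempty) ∧
        List.IsChain (fun X Y => Y ⊂ X) (X₀ :: l.map Prod.fst) ∧
        (∀ F ∈ En :: l.map Prod.snd, F = 0 ∨ ∃ v : List α, v ≠ [] ∧ PartDerivs I E v F) ∧
        WeakEq E' (starDev I E X₀ l En)) ∧
    -- finiteness for star-connected expressions
    (∀ E : RegularExpression α, StarConnected I E →
      (antimirovNFA I E).accepts = traceSem I E ∧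
      Finite (Quotient (weakSetoid I E)) ∧
      (quotientNFA (antimirovNFA I E) (weakSetoid I E)).accepts = traceSem I E) :=
  ⟨fun _ _ h => h.matches'_eq,
    fun E E' u h => by
      by_cases hu : u = []
      · exact ⟨E, .inl rfl, by rw [h.eq_of_nil hu]; exact .refl E⟩
      · obtain ⟨E'', h1, h2⟩ := h.exists_succPlus hu
        exact ⟨E'', .inr h1, h2⟩,
    fun _ _ _ hE h => h.star_inv_of_connected hirr hsymm hE,
    fun E hE => ⟨antimirovNFA_accepts hsymm E, (hE.finiteDerivs hirr hsymm).finite_quotient,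
      quotientNFA_accepts hsymm E⟩⟩
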